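/- A graph $G$ is $(a,b)$-choosable if for every assignment $L$ of a set $L(x)$ of $a$ colours to each vertex $x$ of $G$ one can choose sets $\phi(x)\subseteq L(x)$ with $|\phi(x)|=b$ for every vertex $x$, such that $\phi(x)\cap\phi(y)=\emptyset$ for every edge $xy$ of $G$. Let $\Theta_{k_1,\dots,k_q}$ denote the graph consisting of internally vertex-disjoint paths of lengths $k_1,\dots,k_q$ (numbers of edges) connecting two distinct vertices $u$ and $v$. **Theorem.** Let $G$ be one of the following graphs: 1. $\Theta_{2r,2s,2t}$ with integers $r,s,t>1$; 2. $\Theta_{2r+1,2s+1,2t+1}$ with integers $r,s,t>0$; 3. $\Theta_{2,2,2,2t}$ with an integer $t\ge 1$. Then $G$ is $(2m+1,m)$-choosable for every positive integer $m$. -/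

import Mathlib

universe u w

/-- `G` is `(a, b)`-choosable: for every assignment `L` of sets of `a` colours to the vertices, there
is an `(L, b)`-colouring, that is, a choice of `b`-element sets `φ v ⊆ L v` such that `φ x` and
`φ y` are disjoint whenever `x` and `y` are adjacent. The colours may come from any type. -/
def IsChoosable {V : Type u} (G : SimpleGraph V) (a b : ℕ) : Prop :=
  ∀ (C : Type w) (L : V → Finset C), (∀ v, (L v).card = a) →
    ∃ φ : V → Finset C, (∀ v, (φ v).card = b) ∧ (∀ v, φ v ⊆ L v) ∧
      ∀ x y, G.Adj x y → Disjoint (φ x) (φ y)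

/-- The vertices of the generalised theta graph with path lengths `k 0, …, k (q - 1)`: two branch
vertices `u`, `v`, and `k i - 1` internal vertices on the `i`-th path (so all the internal vertices
of all the paths are distinct). -/
inductive ThetaVertex {q : ℕ} (k : Fin q → ℕ) : Type
  | u : ThetaVertex k
  | v : ThetaVertex k
  | inner (i : Fin q) (j : Fin (k i - 1)) : ThetaVertex k

/-- The vertex in position `j` on the `i`-th path, for `0 ≤ j ≤ k i`: position `0` is `u`,
position `k i` is `v`, and the positions `1, …, k i - 1` are the internal vertices. -/
def thetaPath {q : ℕ} (k : Fin q → ℕ) (i : Fin q) (j : ℕ) : ThetaVertex k :=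
  if j = 0 then ThetaVertex.u
  else if h : j - 1 < k i - 1 then ThetaVertex.inner i ⟨j - 1, h⟩
  else ThetaVertex.v

/-- The generalised theta graph `Θ_{k 0, …, k (q - 1)}` (for positive path lengths): internally
vertex-disjoint paths of lengths `k 0, …, k (q - 1)` joining `u` and `v`. The edges are the pairs of
consecutive vertices on one of the paths. -/
def thetaGraph {q : ℕ} (k : Fin q → ℕ) : SimpleGraph (ThetaVertex k) :=
  SimpleGraph.fromRel fun x y =>
    ∃ i : Fin q, ∃ j : ℕ, j < k i ∧ x = thetaPath k i j ∧ y = thetaPath k i (j + 1)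

/-! ### Extending colours of the two ends to a path. -/

section Path

variable {C : Type w} [DecidableEq C]

/-! Write `U`, `V` for the lists of the branch vertices and `A ⊆ U`, `B ⊆ V` for their colour sets,
to be chosen so that every path can be completed. Sweeping a path from its far end gives the
criterion `pathColourable_of_card_le`: it suffices that `A` meets the residue in at most as many
colours as the excess. Both quantities depend explicitly on `B` (`EvenDependence`, `OddDependence`),
so each path becomes one linear condition on the pair `A`, `B`: a damage, counted colour by colour,
must not exceed the excess for an empty far set. The bounds on that excess leave some slack over the
average damage of a random choice, and the rest of the proof fits an integral choice into this
slack.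

When the paths have an even number of internal vertices, `A` and `B` are taken disjoint. A bijection
from `U` to `V` fixing `U ∩ V` reduces the choice to two disjoint `m`-sets among `2m + 1` elements
that balance three conditions. The fractional point with all coordinates `1/2` satisfies them; a
basic solution has at most four fractional coordinates, and these can be rounded at total cost below
2 (`exists_balanced_halves`).

When the paths have an odd number of internal vertices, `A = S ∩ U` and `B = S ∩ V` for one set `S`,
and there are at most four conditions. The constant point `m / (2m + 1)` satisfies them with room 1
or 2 to spare. A basic solution has at most six fractional coordinates. It is rounded to a nearby
`0/1` point with the same sums over `U` and `V` (`exists_close_rounding`), and Cauchy–Schwarz bounds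
the effect on weights by less than 2 or 3 (`IsSmallError.sum_lt_two`, `IsSmallError.sum_lt_three`).
Integrality then recovers the required bounds (`exists_light_subset`). -/

/-- Greedy residues of a path: starting from the colour set `B` behind the far end, every vertex
keeps the colours of its list that the next vertex has not kept. This is the set kept by the first
of the `n` vertices with lists `L 0, …, L (n - 1)`. -/
def residue (B : Finset C) : ℕ → (ℕ → Finset C) → Finset C
  | 0, _ => B
  | n + 1, L => L 0 \ residue B n (fun j => L (j + 1))

/-- The sum of `|residue| - m` over the vertices of the path. -/
def excess (m : ℕ) (B : Finset C) : ℕ → (ℕ → Finset C) → ℤ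
  | 0, _ => 0
  | n + 1, L => ((residue B (n + 1) L).card : ℤ) - m + excess m B n (fun j => L (j + 1))

/-- A path with lists `L 0, …, L (n - 1)` between two vertices coloured `A` and `B` has an
`m`-fold list colouring; `φ 0 = A` and `φ (n + 1) = B` are the colours of the ends. -/
def PathColourable (m : ℕ) (A B : Finset C) (n : ℕ) (L : ℕ → Finset C) : Prop :=
  ∃ φ : ℕ → Finset C, φ 0 = A ∧ φ (n + 1) = B ∧
    (∀ j < n, φ (j + 1) ⊆ L j ∧ (φ (j + 1)).card = m) ∧
    ∀ j ≤ n, Disjoint (φ j) (φ (j + 1))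

/-- Two consecutive residues cover the list of the first of the two vertices, so together they have
at least `2m + 1` colours, one more than the `2m` subtracted. -/
theorem excess_add_two {m : ℕ} (B : Finset C) (n : ℕ) {L : ℕ → Finset C}
    (hL : ∀ j, (L j).card = 2 * m + 1) :
    1 + excess m B n (fun j => L (j + 2)) ≤ excess m B (n + 2) L := by
  have h : (L 0).card ≤ (residue B (n + 2) L).card
      + (residue B (n + 1) (fun j => L (j + 1))).card := by
    rw [residue]
    exact Finset.card_le_card_sdiff_add_card
  have h2 : excess m B (n + 2) L = ((residue B (n + 2) L).card : ℤ) - m +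
    (((residue B (n + 1) (fun j => L (j + 1))).card : ℤ) - m +
      excess m B n (fun j => L (j + 2))) := rfl
  have := hL 0
  omega

theorem le_excess_even {m : ℕ} (B : Finset C) (a : ℕ) : ∀ {L : ℕ → Finset C},
    (∀ j, (L j).card = 2 * m + 1) → (a : ℤ) ≤ excess m B (2 * a) L := by
  induction a with
  | zero => intro L _; simp [excess]
  | succ a ih =>
    intro L hL
    have h1 := excess_add_two B (2 * a) hL
    have h2 := ih (L := fun j => L (j + 2)) fun j => hL _
    rw [show 2 * (a + 1) = 2 * a + 2 by ring]
    push_cast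
    omega

theorem le_excess_odd {m : ℕ} (B : Finset C) (a : ℕ) : ∀ {L : ℕ → Finset C},
    (∀ j, (L j).card = 2 * m + 1) → (a : ℤ) + m + 1 - B.card ≤ excess m B (2 * a + 1) L := by
  induction a with
  | zero =>
    intro L hL
    have h1 : (L 0).card ≤ (L 0 \ B).card + B.card := Finset.card_le_card_sdiff_add_card
    have h2 := hL 0
    simp only [excess, residue]
    push_cast
    omega
  | succ a ih =>
    intro L hL
    have h1 := excess_add_two B (2 * a + 1) hL
    have h2 := ih (L := fun j => L (j + 2)) fun j => hL _
    rw [show 2 * (a + 1) + 1 = 2 * a + 1 + 2 by ring]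
    push_cast
    omega

/-- The first vertex is counted exactly and the other `2a` in pairs. No bound on `B` is needed, so
the lemma also applies to a whole list in the role of `B`. -/
theorem le_excess_odd_of_residue {m : ℕ} (B : Finset C) (a : ℕ) {L : ℕ → Finset C}
    (hL : ∀ j, (L j).card = 2 * m + 1) :
    (a : ℤ) + (residue B (2 * a + 1) L).card - m ≤ excess m B (2 * a + 1) L := by
  have h := le_excess_even B a (L := fun j => L (j + 1)) fun j => hL _
  rw [excess]
  omega

theorem excess_nonneg {m : ℕ} {B : Finset C} (hB : B.card ≤ m) (n : ℕ) {L : ℕ → Finset C}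
    (hL : ∀ j, (L j).card = 2 * m + 1) : 0 ≤ excess m B n L := by
  obtain ⟨a, rfl | rfl⟩ := n.even_or_odd'
  · have := le_excess_even B a hL
    omega
  · have := le_excess_odd B a hL
    omega

/-- A subset of `M` of given size that meets `Z` as little as possible. -/
theorem exists_subset_card_inter_le {M Z : Finset C} {m s : ℕ} (hM : m ≤ M.card)
    (h : m ≤ (M \ Z).card + s) : ∃ T ⊆ M, T.card = m ∧ (T ∩ Z).card ≤ s := by
  by_cases hc : m ≤ (M \ Z).card
  · obtain ⟨T, hT, hTm⟩ := Finset.exists_subset_card_eq hc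
    refine ⟨T, hT.trans Finset.sdiff_subset, hTm, ?_⟩
    have : T ∩ Z = ∅ := by
      rw [← Finset.disjoint_iff_inter_eq_empty]
      exact Finset.disjoint_of_subset_left hT Finset.sdiff_disjoint
    simp [this]
  · push Not at hc
    obtain ⟨T, h1, h2, h3⟩ := Finset.exists_subsuperset_card_eq
      (Finset.sdiff_subset : M \ Z ⊆ M) hc.le hM
    refine ⟨T, h2, h3, ?_⟩
    have h4 : (T ∩ Z).card + (T \ Z).card = T.card := Finset.card_inter_add_card_sdiff T Z
    have h5 : (M \ Z).card ≤ (T \ Z).card := Finset.card_le_card fun c hc => by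
      have := h1 hc
      simp only [Finset.mem_sdiff] at hc ⊢
      exact ⟨this, hc.2⟩
    omega

/-- Colour from the near end. The first vertex takes `m` colours outside `A`, as few as possible
from the next residue; the inequality says exactly that this overlap can be kept within the excess
of the remaining path. -/
theorem pathColourable_of_card_le {m : ℕ} {B : Finset C} (hB : B.card ≤ m) (n : ℕ) :
    ∀ {A : Finset C} {L : ℕ → Finset C}, A.card ≤ m → (∀ j, (L j).card = 2 * m + 1) →
      ((A ∩ residue B n L).card : ℤ) ≤ excess m B n L → PathColourable m A B n L := by
  induction n with
  | zero =>
    intro A L _ _ h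
    have h0 : A ∩ B = ∅ := by
      rw [← Finset.card_eq_zero]
      simp only [residue, excess] at h
      omega
    refine ⟨fun j => if j = 0 then A else B, rfl, rfl, by simp, fun j hj => ?_⟩
    obtain rfl : j = 0 := by omega
    simpa [Finset.disjoint_iff_inter_eq_empty] using h0
  | succ n ih =>
    intro A L hA hL h
    have hL' : ∀ j, (L (j + 1)).card = 2 * m + 1 := fun j => hL _
    have hs := excess_nonneg hB n hL'
    obtain ⟨s, hs'⟩ := Int.eq_ofNat_of_zero_le hs
    set Z := residue B n fun j => L (j + 1) with hZ
    have hexc : excess m B (n + 1) L = ((L 0 \ Z).card : ℤ) - m + s := by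
      rw [excess, hs']; rfl
    have hres : residue B (n + 1) L = L 0 \ Z := rfl
    rw [hexc, hres] at h
    have h1 : (A ∩ (L 0 \ Z)).card + ((L 0 \ A) \ Z).card = (L 0 \ Z).card := by
      rw [← Finset.card_inter_add_card_sdiff (L 0 \ Z) A, Finset.inter_comm, sdiff_right_comm]
    have h2 : (L 0).card ≤ (L 0 \ A).card + A.card := Finset.card_le_card_sdiff_add_card
    have h3 := hL 0
    obtain ⟨T, hT, hTm, hTZ⟩ := exists_subset_card_inter_le (M := L 0 \ A) (Z := Z) (m := m)
      (s := s) (by omega) (by omega)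
    obtain ⟨φ, p1, p2, p3, p4⟩ := ih (A := T) hTm.le hL' (by rw [hs']; exact_mod_cast hTZ)
    refine ⟨fun j => j.casesOn A φ, rfl, p2, fun j hj => ?_, fun j hj => ?_⟩
    · cases j with
      | zero =>
        change φ 0 ⊆ _ ∧ (φ 0).card = m
        rw [p1]
        exact ⟨hT.trans Finset.sdiff_subset, hTm⟩
      | succ j => exact p3 j (by omega)
    · cases j with
      | zero =>
        change Disjoint A (φ 0)
        rw [p1]
        exact (Finset.disjoint_of_subset_left hT Finset.sdiff_disjoint).symm
      | succ j => exact p4 j (by omega)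

/-- How the residue and the excess of a path with an even number of vertices depend on the colour
set at the far end. -/
def EvenDependence (m : ℕ) (V : Finset C) (n : ℕ) (L : ℕ → Finset C) (Y Λ : Finset C) : Prop :=
  Y ⊆ V ∧ Λ ⊆ V ∧ Disjoint (residue ∅ n L) Λ ∧ Disjoint Y Λ ∧
    ∀ B ⊆ V, residue B n L = residue ∅ n L ∪ B ∩ Λ ∧
      excess m B n L = excess m ∅ n L - (B ∩ Y).card

/-- How the residue and the excess of a path with an odd number of vertices depend on the colour
set at the far end. -/
def OddDependence (m : ℕ) (V : Finset C) (n : ℕ) (L : ℕ → Finset C) (Y Λ : Finset C) : Prop :=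
  Y ⊆ V ∧ Λ ⊆ V ∧ Λ ⊆ residue ∅ n L ∧ Λ ⊆ Y ∧
    ∀ B ⊆ V, residue B n L = residue ∅ n L \ (B ∩ Λ) ∧
      excess m B n L = excess m ∅ n L - (B ∩ Y).card

/-- The colours in `Λ` are those through which `B` still influences the residue. Those also in the
new list are now deleted from the residue rather than added, each costing one unit of excess, so
they join `Y`. -/
theorem EvenDependence.succ {m : ℕ} {V : Finset C} {n : ℕ} {L : ℕ → Finset C} {Y Λ : Finset C}
    (h : EvenDependence m V n (fun j => L (j + 1)) Y Λ) :
    OddDependence m V (n + 1) L (Y ∪ L 0 ∩ Λ) (L 0 ∩ Λ) := by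
  obtain ⟨h1, h2, h3, h4, h5⟩ := h
  have hsub : L 0 ∩ Λ ⊆ residue ∅ (n + 1) L := by
    intro c hc
    simp only [residue, Finset.mem_sdiff, Finset.mem_inter] at hc ⊢
    exact ⟨hc.1, Finset.disjoint_right.1 h3 hc.2⟩
  refine ⟨Finset.union_subset h1 (Finset.inter_subset_right.trans h2),
    Finset.inter_subset_right.trans h2, hsub, Finset.subset_union_right, fun B hB => ?_⟩
  obtain ⟨e1, e2⟩ := h5 B hB
  have hr : residue B (n + 1) L = residue ∅ (n + 1) L \ (B ∩ (L 0 ∩ Λ)) := by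
    simp only [residue]
    rw [e1]
    ext c
    simp only [Finset.mem_sdiff, Finset.mem_inter, Finset.mem_union]
    tauto
  refine ⟨hr, ?_⟩
  have hc : (residue ∅ (n + 1) L \ (B ∩ (L 0 ∩ Λ))).card + (B ∩ (L 0 ∩ Λ)).card =
      (residue ∅ (n + 1) L).card :=
    Finset.card_sdiff_add_card_eq_card (Finset.inter_subset_right.trans hsub)
  have hu : (B ∩ (Y ∪ L 0 ∩ Λ)).card = (B ∩ Y).card + (B ∩ (L 0 ∩ Λ)).card := by
    rw [Finset.inter_union_distrib_left, Finset.card_union_of_disjoint]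
    exact Finset.disjoint_of_subset_left Finset.inter_subset_right
      (Finset.disjoint_of_subset_right
        (Finset.inter_subset_right.trans Finset.inter_subset_right) h4)
  rw [excess, excess, hr, e2, hu]
  push_cast
  omega

/-- A deleted colour that survives in the new list reappears in its residue; this gain cancels the
earlier loss, so the colour leaves `Y`. -/
theorem OddDependence.succ {m : ℕ} {V : Finset C} {n : ℕ} {L : ℕ → Finset C} {Y Λ : Finset C}
    (h : OddDependence m V n (fun j => L (j + 1)) Y Λ) :
    EvenDependence m V (n + 1) L (Y \ (L 0 ∩ Λ)) (L 0 ∩ Λ) := by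
  obtain ⟨h1, h2, h3, h4, h5⟩ := h
  have hdis : Disjoint (residue ∅ (n + 1) L) (L 0 ∩ Λ) := by
    rw [Finset.disjoint_left]
    intro c hc hc'
    simp only [residue, Finset.mem_sdiff, Finset.mem_inter] at hc hc'
    exact hc.2 (h3 hc'.2)
  refine ⟨Finset.sdiff_subset.trans h1, Finset.inter_subset_right.trans h2, hdis,
    Finset.sdiff_disjoint, fun B hB => ?_⟩
  obtain ⟨e1, e2⟩ := h5 B hB
  have hr : residue B (n + 1) L = residue ∅ (n + 1) L ∪ B ∩ (L 0 ∩ Λ) := by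
    simp only [residue]
    rw [e1]
    ext c
    have := @h3 c
    simp only [Finset.mem_sdiff, Finset.mem_inter, Finset.mem_union]
    tauto
  refine ⟨hr, ?_⟩
  have hc : (residue ∅ (n + 1) L ∪ B ∩ (L 0 ∩ Λ)).card =
      (residue ∅ (n + 1) L).card + (B ∩ (L 0 ∩ Λ)).card :=
    Finset.card_union_of_disjoint (Finset.disjoint_of_subset_right Finset.inter_subset_right hdis)
  have hu : (B ∩ (Y \ (L 0 ∩ Λ))).card + (B ∩ (L 0 ∩ Λ)).card = (B ∩ Y).card := by
    rw [← Finset.card_union_of_disjoint]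
    · congr 1
      ext c
      have := @h4 c
      simp only [Finset.mem_sdiff, Finset.mem_inter, Finset.mem_union]
      tauto
    · exact Finset.disjoint_of_subset_left Finset.inter_subset_right
        (Finset.disjoint_of_subset_right Finset.inter_subset_right Finset.sdiff_disjoint)
  rw [excess, excess, hr, e2, hc]
  push_cast
  omega

theorem exists_evenDependence (m : ℕ) (V : Finset C) (a : ℕ) :
    ∀ L : ℕ → Finset C, ∃ Y Λ, EvenDependence m V (2 * a) L Y Λ := by
  induction a with
  | zero =>
    refine fun L => ⟨∅, V, by simp, subset_rfl, by simp [residue], by simp, fun B hB => ?_⟩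
    simp [residue, excess, Finset.inter_eq_left.2 hB]
  | succ a ih =>
    intro L
    obtain ⟨Y, Λ, h⟩ := ih fun j => L (j + 2)
    exact ⟨_, _, (EvenDependence.succ (L := fun j => L (j + 1)) h).succ⟩

theorem exists_oddDependence (m : ℕ) (V : Finset C) (a : ℕ) (L : ℕ → Finset C) :
    ∃ Y Λ, OddDependence m V (2 * a + 1) L Y Λ := by
  obtain ⟨Y, Λ, h⟩ := exists_evenDependence m V a fun j => L (j + 1)
  exact ⟨_, _, h.succ⟩

theorem pathColourable_one {m : ℕ} {A B : Finset C} (hA : A.card = m) (hB : B.card = m)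
    {L : ℕ → Finset C} (hL : ∀ j, (L j).card = 2 * m + 1)
    (h : (L 0 ∩ (A ∪ B)).card ≤ m + 1) : PathColourable m A B 1 L := by
  refine pathColourable_of_card_le hB.le 1 hA.le hL ?_
  have h1 : (L 0 ∩ (A ∪ B)).card = (L 0 ∩ B).card + (A ∩ (L 0 \ B)).card := by
    rw [← Finset.card_union_of_disjoint]
    · congr 1
      ext c
      simp only [Finset.mem_sdiff, Finset.mem_inter, Finset.mem_union]
      tauto
    · rw [Finset.disjoint_left]
      intro c
      simp only [Finset.mem_sdiff, Finset.mem_inter]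
      tauto
  have h2 : (L 0 ∩ B).card + (L 0 \ B).card = (L 0).card := Finset.card_inter_add_card_sdiff _ _
  have h3 := hL 0
  simp only [residue, excess]
  omega

theorem exists_condition_odd {m : ℕ} (V : Finset C) {a : ℕ} (ha : 1 ≤ a) {L : ℕ → Finset C}
    (hL : ∀ j, (L j).card = 2 * m + 1) :
    ∃ (X Y Λ : Finset C) (t : ℤ), Y ⊆ V ∧ Λ ⊆ V ∧ Λ ⊆ X ∧ (m : ℤ) + 2 ≤ t ∧
      (X.card : ℤ) + Y.card - Λ.card + 1 - m ≤ t ∧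
      ∀ A B : Finset C, A.card = m → B.card = m → B ⊆ V →
        ((A ∩ X).card : ℤ) + (B ∩ Y).card - (A ∩ B ∩ Λ).card ≤ t →
        PathColourable m A B (2 * a + 1) L := by
  obtain ⟨Y, Λ, h1, h2, h3, h4, h5⟩ := exists_oddDependence m V a L
  refine ⟨residue ∅ (2 * a + 1) L, Y, Λ, excess m ∅ (2 * a + 1) L, h1, h2, h3, ?_, ?_, ?_⟩
  · have := le_excess_odd (m := m) ∅ a hL
    simp only [Finset.card_empty] at this
    omega
  -- The dependence formulas hold for every subset of `V`; taking all of `V` as the far set bounds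
  -- `X`, `Y`, `Λ` simultaneously.
  · obtain ⟨e1, e2⟩ := h5 V subset_rfl
    have h6 := le_excess_odd_of_residue V a hL
    rw [e2, e1, Finset.inter_eq_right.2 h2, Finset.inter_eq_right.2 h1] at h6
    have h7 := Finset.card_sdiff_add_card_eq_card h3
    omega
  · intro A B hA hB hBV h
    obtain ⟨e1, e2⟩ := h5 B hBV
    refine pathColourable_of_card_le hB.le _ hA.le hL ?_
    have h6 : (A ∩ (residue ∅ (2 * a + 1) L \ (B ∩ Λ))).card + (A ∩ B ∩ Λ).card =
        (A ∩ residue ∅ (2 * a + 1) L).card := by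
      rw [← Finset.card_union_of_disjoint]
      · congr 1
        ext c
        have := @h3 c
        simp only [Finset.mem_sdiff, Finset.mem_inter, Finset.mem_union]
        tauto
      · rw [Finset.disjoint_left]
        intro c
        simp only [Finset.mem_sdiff, Finset.mem_inter]
        tauto
    rw [e1, e2]
    omega

/-- For disjoint `A` and `B` the part of the residue coming from `B` cannot meet `A`, so `Λ` drops
out. The bound on `X` comes from an empty far set, the bound on `Y` from the far set `V`. -/
theorem exists_condition_even {m : ℕ} (V : Finset C) {a : ℕ} (ha : 1 ≤ a) {L : ℕ → Finset C}
    (hL : ∀ j, (L j).card = 2 * m + 1) :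
    ∃ (X Y : Finset C) (t : ℤ), Y ⊆ V ∧ (X.card : ℤ) + 1 ≤ t ∧ (Y.card : ℤ) + 1 ≤ t ∧
      ∀ A B : Finset C, A.card = m → B.card = m → B ⊆ V → Disjoint A B →
        ((A ∩ X).card : ℤ) + (B ∩ Y).card ≤ t → PathColourable m A B (2 * a) L := by
  obtain ⟨Y, Λ, h1, h2, h3, h4, h5⟩ := exists_evenDependence m V a L
  refine ⟨residue ∅ (2 * a) L, Y, excess m ∅ (2 * a) L, h1, ?_, ?_, ?_⟩
  · obtain ⟨a, rfl⟩ := Nat.exists_eq_add_of_le' ha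
    have h6 := le_excess_odd (m := m) ∅ a (L := fun j => L (j + 1)) fun j => hL _
    have h7 : excess m ∅ (2 * a + 1 + 1) L = ((residue ∅ (2 * a + 1 + 1) L).card : ℤ) - m +
      excess m ∅ (2 * a + 1) fun j => L (j + 1) := rfl
    rw [show 2 * (a + 1) = 2 * a + 1 + 1 by ring]
    simp only [Finset.card_empty] at h6
    omega
  · obtain ⟨e1, e2⟩ := h5 V subset_rfl
    have h6 := le_excess_even (m := m) V a hL
    rw [e2, Finset.inter_eq_right.2 h1] at h6
    omega
  · intro A B hA hB hBV hAB h
    obtain ⟨e1, e2⟩ := h5 B hBV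
    refine pathColourable_of_card_le hB.le _ hA.le hL ?_
    have h6 : A ∩ (residue ∅ (2 * a) L ∪ B ∩ Λ) = A ∩ residue ∅ (2 * a) L := by
      ext c
      have : c ∈ A → c ∉ B := fun hc => Finset.disjoint_left.1 hAB hc
      simp only [Finset.mem_inter, Finset.mem_union]
      tauto
    rw [e1, e2, h6]
    omega

end Path

/-! ### Basic solutions of linear programs in a box. -/

section LinearProgramming

variable {E : Type*} [Fintype E] {ι : Type*}

/-- A linear program in a box has an optimal solution whose coordinates strictly inside the box
are determined by the constraint rows. -/
theorem exists_basic_solution (lo hi : E → ℝ) (R : ι → E → ℝ) {J : ι → Set ℝ}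
    (hJ : ∀ r, IsClosed (J r)) (l x₀ : E → ℝ) (hx₀ : ∀ j, lo j ≤ x₀ j ∧ x₀ j ≤ hi j)
    (hR₀ : ∀ r, ∑ j, R r j * x₀ j ∈ J r) :
    ∃ x : E → ℝ, (∀ j, lo j ≤ x j ∧ x j ≤ hi j) ∧ (∀ r, ∑ j, R r j * x j ∈ J r) ∧
      ∑ j, l j * x₀ j ≤ ∑ j, l j * x j ∧
      ∀ g : E → ℝ, (∀ j, g j ≠ 0 → lo j < x j ∧ x j < hi j) → (∀ r, ∑ j, R r j * g j = 0) →
        g = 0 := by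
  set K : Set (E → ℝ) := Set.Icc lo hi ∩ ⋂ r, {x | ∑ j, R r j * x j ∈ J r} with hK
  have memK : ∀ x, x ∈ K ↔ (∀ j, lo j ≤ x j ∧ x j ≤ hi j) ∧ ∀ r, ∑ j, R r j * x j ∈ J r := by
    intro x
    simp [hK, Pi.le_def, forall_and]
  have hKc : IsCompact K := isCompact_Icc.inter_right
    (isClosed_iInter fun r => (hJ r).preimage (by fun_prop))
  have hl : Continuous fun x : E → ℝ => ∑ j, l j * x j := by fun_prop
  obtain ⟨x₁, hx₁, hmax⟩ := hKc.exists_isMaxOn ⟨x₀, (memK x₀).2 ⟨hx₀, hR₀⟩⟩ hl.continuousOn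
  have hF : IsCompact (K ∩ {x | ∑ j, l j * x j = ∑ j, l j * x₁ j}) :=
    hKc.inter_right (isClosed_eq hl continuous_const)
  -- An extreme point of the optimal face: a direction `g` killed by all rows and supported strictly
  -- inside the box would make `x` the midpoint of `x ± ε g`.
  obtain ⟨x, ⟨hxK, hxl⟩, hext⟩ := hF.extremePoints_nonempty ⟨x₁, hx₁, rfl⟩
  simp only [Set.mem_ofPred_eq] at hxl
  have hx := (memK x).1 hxK
  refine ⟨x, hx.1, hx.2, ?_, fun g hg hRg => ?_⟩
  · rw [hxl]
    exact hmax ((memK x₀).2 ⟨hx₀, hR₀⟩)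
  · have key : ∀ᶠ ε in nhdsWithin (0 : ℝ) (Set.Ioi 0), ∀ j,
        (lo j ≤ x j + ε * g j ∧ x j + ε * g j ≤ hi j) ∧
          (lo j ≤ x j - ε * g j ∧ x j - ε * g j ≤ hi j) := by
      rw [Filter.eventually_all]
      intro j
      by_cases hgj : g j = 0
      · simp [hgj, hx.1 j]
      · obtain ⟨h1, h2⟩ := hg j hgj
        have c1 : Filter.Tendsto (fun ε : ℝ => x j + ε * g j) (nhdsWithin 0 (Set.Ioi 0))
            (nhds (x j)) := by
          have : Continuous fun ε : ℝ => x j + ε * g j := by fun_prop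
          simpa using (this.tendsto 0).mono_left nhdsWithin_le_nhds
        have c2 : Filter.Tendsto (fun ε : ℝ => x j - ε * g j) (nhdsWithin 0 (Set.Ioi 0))
            (nhds (x j)) := by
          have : Continuous fun ε : ℝ => x j - ε * g j := by fun_prop
          simpa using (this.tendsto 0).mono_left nhdsWithin_le_nhds
        filter_upwards [c1.eventually (Icc_mem_nhds h1 h2), c2.eventually (Icc_mem_nhds h1 h2)]
          with ε e1 e2 using ⟨e1, e2⟩
    obtain ⟨ε, hε, hε0⟩ := (key.and self_mem_nhdsWithin).exists
    replace hε0 : 0 < ε := hε0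
    have hadd : ∀ a : E → ℝ, ∑ j, a j * (x j + ε * g j) = ∑ j, a j * x j + ε * ∑ j, a j * g j := by
      intro a
      rw [Finset.mul_sum, ← Finset.sum_add_distrib]
      exact Finset.sum_congr rfl fun j _ => by ring
    have hsub : ∀ a : E → ℝ, ∑ j, a j * (x j - ε * g j) = ∑ j, a j * x j - ε * ∑ j, a j * g j := by
      intro a
      rw [Finset.mul_sum, ← Finset.sum_sub_distrib]
      exact Finset.sum_congr rfl fun j _ => by ring
    have k1 : (fun j => x j + ε * g j) ∈ K := (memK _).2
      ⟨fun j => (hε j).1, fun r => by simpa [hadd, hRg r] using hx.2 r⟩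
    have k2 : (fun j => x j - ε * g j) ∈ K := (memK _).2
      ⟨fun j => (hε j).2, fun r => by simpa [hsub, hRg r] using hx.2 r⟩
    have m1 : ∑ j, l j * (x j + ε * g j) ≤ ∑ j, l j * x₁ j := hmax k1
    have m2 : ∑ j, l j * (x j - ε * g j) ≤ ∑ j, l j * x₁ j := hmax k2
    rw [hadd, hxl] at m1
    rw [hsub, hxl] at m2
    have hlg : ε * ∑ j, l j * g j = 0 := by linarith
    have := hext (x₁ := fun j => x j + ε * g j) ⟨k1, by simp [hadd, hlg, hxl]⟩
      (x₂ := fun j => x j - ε * g j) ⟨k2, by simp [hsub, hlg, hxl]⟩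
      ⟨1 / 2, 1 / 2, by norm_num, by norm_num, by norm_num, by ext j; simp; ring⟩
    ext j
    have hj := congrFun this j
    simp only [add_eq_left, mul_eq_zero, hε0.ne', false_or] at hj
    simpa using hj

theorem card_le_of_rows_injective [Fintype ι] (R : ι → E → ℝ) (F : Finset E)
    (h : ∀ g : E → ℝ, (∀ j ∉ F, g j = 0) → (∀ r, ∑ j, R r j * g j = 0) → g = 0) :
    F.card ≤ Fintype.card ι := by
  classical
  let T : (F → ℝ) →ₗ[ℝ] (ι → ℝ) :=
    (Matrix.of R).mulVecLin ∘ₗ Function.ExtendByZero.linearMap ℝ (Subtype.val : F → E)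
  have hT : Function.Injective T := by
    rw [← LinearMap.ker_eq_bot, LinearMap.ker_eq_bot']
    intro g hg
    have := h (Function.extend Subtype.val g 0) (fun j hj => by
      rw [Function.extend_apply' _ _ _ (by rintro ⟨a, rfl⟩; exact hj a.2)]; rfl)
      (fun r => congrFun hg r)
    ext j
    have hj := congrFun this j
    rwa [Subtype.val_injective.extend_apply] at hj
  simpa using LinearMap.finrank_le_finrank_of_injective hT

end LinearProgramming

/-! ### Balanced disjoint halves of a set of odd size. -/

section Balancing

variable {E : Type*} [DecidableEq E]

/-- One coordinate `z` is discarded and the others are rounded, up on `S` and down elsewhere. Apart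
from the trivial extremes of `k`, either the largest coordinate alone is rounded up, or the smallest
remaining one alone is rounded down. As that one is at least `3/8`, respectively at most `5/8`, the
cost is below `7/4`. -/
theorem exists_balanced_split_four {F : Finset E} {x : E → ℝ} (hx : ∀ j ∈ F, 0 < x j ∧ x j < 1)
    (hF : F.card ≤ 4) {k : ℤ} (hk : ∑ j ∈ F, x j = k + 1 / 2) :
    ∃ z ∈ F, ∃ S ⊆ F.erase z, (S.card : ℤ) = k ∧
      ∑ j ∈ S, (1 - x j) + ∑ j ∈ F.erase z \ S, x j < 2 := by
  have hne : F.Nonempty := by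
    rw [Finset.nonempty_iff_ne_empty]
    rintro rfl
    simp only [Finset.sum_empty] at hk
    have h2 : (2 * k + 1 : ℝ) = 0 := by linarith
    have : 2 * k + 1 = 0 := by exact_mod_cast h2
    omega
  have hpos : 0 < ∑ j ∈ F, x j := Finset.sum_pos (fun j hj => (hx j hj).1) hne
  have hlt : ∑ j ∈ F, x j < F.card := by
    have : ∑ j ∈ F, x j < ∑ j ∈ F, (1 : ℝ) := Finset.sum_lt_sum_of_nonempty hne
      fun j hj => (hx j hj).2
    simpa using this
  have hk0 : 0 ≤ k := by
    have h : (-1 : ℝ) < k := by linarith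
    have h' : -1 < k := by exact_mod_cast h
    omega
  have hk1 : k + 1 ≤ F.card := by
    have h : (k : ℝ) < F.card := by linarith
    have h' : k < F.card := by exact_mod_cast h
    omega
  have her : ∀ z ∈ F, ∑ j ∈ F.erase z, x j = k + 1 / 2 - x z := fun z hz => by
    rw [← hk, ← Finset.add_sum_erase F x hz]; ring
  rcases hk0.eq_or_lt with rfl | hk0
  · obtain ⟨z, hz⟩ := hne
    refine ⟨z, hz, ∅, by simp, by simp, ?_⟩
    have h1 := her z hz
    have h2 := (hx z hz).1
    rw [Finset.sum_empty, Finset.sdiff_empty, h1, Int.cast_zero]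
    linarith
  rcases hk1.eq_or_lt with hk1 | hk1
  · obtain ⟨z, hz⟩ := hne
    refine ⟨z, hz, F.erase z, subset_rfl, ?_, ?_⟩
    · rw [Finset.card_erase_of_mem hz]
      have := Finset.card_pos.2 ⟨z, hz⟩
      omega
    · have h1 := her z hz
      have h2 := (hx z hz).2
      have h3 : ((F.erase z).card : ℝ) = k := by
        rw [Finset.card_erase_of_mem hz]
        have := Finset.card_pos.2 ⟨z, hz⟩
        have h4 : ((F.card - 1 : ℕ) : ℤ) = k := by omega
        exact_mod_cast h4
      simp only [Finset.sum_sub_distrib, Finset.sum_const, Finset.sdiff_self, Finset.sum_empty, h1,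
        nsmul_eq_mul, h3]
      linarith
  have hk2 : k = 1 ∨ k = 2 := by omega
  rcases hk2 with rfl | rfl
  · obtain ⟨a, ha, hmax⟩ := F.exists_max_image x hne
    obtain ⟨z, hz⟩ : (F.erase a).Nonempty := by
      rw [← Finset.card_pos, Finset.card_erase_of_mem ha]; omega
    rw [Finset.mem_erase] at hz
    have haz : a ∈ F.erase z := Finset.mem_erase.2 ⟨hz.1.symm, ha⟩
    refine ⟨z, hz.2, {a}, by simpa using haz, by simp, ?_⟩
    have h1 := her z hz.2
    rw [← Finset.add_sum_erase _ x haz] at h1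
    rw [Finset.sum_singleton, Finset.sdiff_singleton_eq_erase]
    have h2 := (hx z hz.2).1
    have h3 : ∑ j ∈ F, x j ≤ F.card • x a := Finset.sum_le_card_nsmul _ _ _ hmax
    have h4 : (F.card : ℝ) ≤ 4 := by exact_mod_cast hF
    have h5 := (hx a ha).1
    rw [nsmul_eq_mul, hk] at h3
    push_cast at *
    nlinarith
  · obtain ⟨b, hb, hmin⟩ := F.exists_min_image x hne
    obtain ⟨z, hz⟩ : (F.erase b).Nonempty := by
      rw [← Finset.card_pos, Finset.card_erase_of_mem hb]; omega
    rw [Finset.mem_erase] at hz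
    have hbz : b ∈ F.erase z := Finset.mem_erase.2 ⟨hz.1.symm, hb⟩
    have hc4 : F.card = 4 := by omega
    have hc : ((F.erase z).erase b).card = 2 := by
      rw [Finset.card_erase_of_mem hbz, Finset.card_erase_of_mem hz.2, hc4]
    refine ⟨z, hz.2, (F.erase z).erase b, Finset.erase_subset _ _, by simp [hc], ?_⟩
    have h1 := her z hz.2
    rw [← Finset.add_sum_erase _ x hbz] at h1
    rw [Finset.sdiff_erase_self hbz, Finset.sum_singleton, Finset.sum_sub_distrib]
    have h2 := (hx z hz.2).2
    have h3 : F.card • x b ≤ ∑ j ∈ F, x j := Finset.card_nsmul_le_sum _ _ _ hmin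
    rw [nsmul_eq_mul, hk, hc4] at h3
    simp only [Finset.sum_const, hc]
    push_cast at *
    norm_num at *
    linarith

variable [Fintype E]

/-- Among `2m + 1` elements, two disjoint sets of `m` elements balancing three pairs of sets. -/
theorem exists_balanced_halves {m : ℕ} (hE : Fintype.card E = 2 * m + 1)
    (X Y : Fin 3 → Finset E) :
    ∃ S T : Finset E, Disjoint S T ∧ S.card = m ∧ T.card = m ∧
      ∀ i, (S ∩ X i).card + (T ∩ Y i).card ≤ 1 + max (X i).card (Y i).card := by
  set α : Fin 3 → E → ℝ := fun i j => if j ∈ X i then 1 else 0 with hα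
  set β : Fin 3 → E → ℝ := fun i j => if j ∈ Y i then 1 else 0 with hβ
  have hα01 : ∀ i j, 0 ≤ α i j ∧ α i j ≤ 1 := fun i j => by simp only [hα]; split_ifs <;> simp
  have hβ01 : ∀ i j, 0 ≤ β i j ∧ β i j ≤ 1 := fun i j => by simp only [hβ]; split_ifs <;> simp
  have hαs : ∀ i (A : Finset E), ∑ j ∈ A, α i j = (A ∩ X i).card := fun i A => by
    simp [hα, Finset.sum_ite_mem]
  have hβs : ∀ i (A : Finset E), ∑ j ∈ A, β i j = (A ∩ Y i).card := fun i A => by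
    simp [hβ, Finset.sum_ite_mem]
  -- Four equality rows, the total and three balances, hence at most four fractional coordinates.
  let R : Option (Fin 3) → E → ℝ := fun r => r.elim (fun _ => 1) fun i j => α i j - β i j
  obtain ⟨x, hx01, hxR, -, hind⟩ := exists_basic_solution (fun _ : E => (0 : ℝ)) (fun _ => 1) R
    (J := fun r => {∑ j, R r j * (1 / 2)}) (fun _ => isClosed_singleton) (fun _ => 0)
    (fun _ => 1 / 2) (fun _ => by norm_num) fun _ => rfl
  set F : Finset E := Finset.univ.filter fun j => 0 < x j ∧ x j < 1 with hF
  have hF4 : F.card ≤ 4 := by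
    refine card_le_of_rows_injective R F fun g hg => hind g fun j hj => ?_
    by_contra h
    exact hj (hg j (by simpa [hF] using h))
  set N : Finset E := Finset.univ.filter fun j => x j = 1 with hN
  have hsplit : ∀ f : E → ℝ, ∑ j, f j = ∑ j ∈ N, f j + ∑ j ∈ F, f j +
      ∑ j ∈ Finset.univ.filter (fun j => x j = 0), f j := by
    intro f
    have : ∀ j, f j = (if x j = 1 then f j else 0) + (if 0 < x j ∧ x j < 1 then f j else 0) +
        if x j = 0 then f j else 0 := by
      intro j
      obtain ⟨h0, h1⟩ := hx01 j
      rcases h0.eq_or_lt with h0 | h0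
      · simp [← h0]
      · rcases h1.eq_or_lt with h1 | h1
        · simp [h1]
        · simp [h0, h1, h0.ne', h1.ne]
    rw [Finset.sum_congr rfl fun j _ => this j]
    simp only [Finset.sum_add_distrib, Finset.sum_filter, hN, hF]
  set Z : Finset E := Finset.univ.filter fun j => x j = 0 with hZ
  have hsum : ∑ j, x j = m + 1 / 2 := by
    have := hxR none
    simp only [R, Option.elim, one_mul, Set.mem_singleton_iff, Finset.sum_const, Finset.card_univ,
      hE, nsmul_eq_mul] at this
    rw [this]; push_cast; ring
  have hFsum : ∑ j ∈ F, x j = ((m - N.card : ℤ) : ℝ) + 1 / 2 := by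
    have h1 := hsplit x
    rw [hsum, Finset.sum_congr rfl (g := fun _ => (1 : ℝ)) fun j hj => (by simpa [hN] using hj),
      Finset.sum_congr (s₁ := Z) rfl (g := fun _ => (0 : ℝ)) fun j hj => (by simpa [hZ] using hj)]
      at h1
    simp at h1
    push_cast
    linarith
  obtain ⟨z, hzF, S, hSF, hSk, hcost⟩ := exists_balanced_split_four
    (fun j hj => by simpa [hF] using hj) hF4 hFsum
  have dNF : Disjoint N F := by
    rw [Finset.disjoint_left]; simp only [hN, hF, Finset.mem_filter]; intro j h1 h2
    linarith [h1.2, h2.2.2]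
  have dZF : Disjoint Z F := by
    rw [Finset.disjoint_left]; simp only [hZ, hF, Finset.mem_filter]; intro j h1 h2
    linarith [h1.2, h2.2.1]
  have dNZ : Disjoint N Z := by
    rw [Finset.disjoint_left]; simp only [hN, hZ, Finset.mem_filter]; intro j h1 h2
    linarith [h1.2, h2.2]
  have hSF' : S ⊆ F := hSF.trans (Finset.erase_subset _ _)
  have hTF' : F.erase z \ S ⊆ F := Finset.sdiff_subset.trans (Finset.erase_subset _ _)
  have dNS : Disjoint N S := Finset.disjoint_of_subset_right hSF' dNF
  have dZT : Disjoint Z (F.erase z \ S) := Finset.disjoint_of_subset_right hTF' dZF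
  have hcard : N.card + F.card + Z.card = 2 * m + 1 := by
    have := hsplit fun _ => 1
    simp only [Finset.sum_const, nsmul_eq_mul, mul_one, Finset.card_univ, hE] at this
    exact_mod_cast this.symm
  have hFz : (F.erase z).card + 1 = F.card := Finset.card_erase_add_one hzF
  have hST : (F.erase z \ S).card + S.card = (F.erase z).card :=
    Finset.card_sdiff_add_card_eq_card hSF
  refine ⟨N ∪ S, Z ∪ (F.erase z \ S), ?_, ?_, ?_, fun i => ?_⟩
  · rw [Finset.disjoint_union_left, Finset.disjoint_union_right, Finset.disjoint_union_right]
    exact ⟨⟨dNZ, Finset.disjoint_of_subset_right hTF' dNF⟩,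
      (Finset.disjoint_of_subset_right hSF' dZF).symm, Finset.disjoint_sdiff⟩
  · rw [Finset.card_union_of_disjoint dNS]; omega
  · rw [Finset.card_union_of_disjoint dZT]; omega
  · have hmean : ∑ j, (α i j * x j + β i j * (1 - x j)) ≤ max (X i).card (Y i).card := by
      have h1 := hxR (some i)
      simp only [R, Option.elim, Set.mem_singleton_iff, ← Finset.sum_mul,
        Finset.sum_sub_distrib] at h1
      have h2 : ∑ j, (α i j * x j + β i j * (1 - x j)) =
          ∑ j, (α i j - β i j) * x j + ∑ j, β i j := by
        rw [← Finset.sum_add_distrib]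
        exact Finset.sum_congr rfl fun j _ => by ring
      rw [h2, h1, hαs, hβs]
      have h3 := le_max_left ((X i).card : ℝ) (Y i).card
      have h4 := le_max_right ((X i).card : ℝ) (Y i).card
      simp only [Finset.univ_inter, Nat.cast_max]
      linarith
    rw [hsplit] at hmean
    have e1 : ∑ j ∈ N, (α i j * x j + β i j * (1 - x j)) = ∑ j ∈ N, α i j :=
      Finset.sum_congr rfl fun j hj => by
        have : x j = 1 := by simpa [hN] using hj
        rw [this]; ring
    have e2 : ∑ j ∈ Z, (α i j * x j + β i j * (1 - x j)) = ∑ j ∈ Z, β i j :=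
      Finset.sum_congr rfl fun j hj => by
        have : x j = 0 := by simpa [hZ] using hj
        rw [this]; ring
    have e3 : ∑ j ∈ F.erase z, (α i j * x j + β i j * (1 - x j)) ≤
        ∑ j ∈ F, (α i j * x j + β i j * (1 - x j)) := by
      refine Finset.sum_le_sum_of_subset_of_nonneg (Finset.erase_subset _ _) fun j _ _ => ?_
      have := hx01 j
      have := hα01 i j
      have := hβ01 i j
      have : 0 ≤ 1 - x j := by linarith
      exact add_nonneg (mul_nonneg (hα01 i j).1 (hx01 j).1) (mul_nonneg (hβ01 i j).1 this)
    rw [← Finset.sum_sdiff hSF] at e3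
    have e4 : ∑ j ∈ S, α i j ≤ ∑ j ∈ S, (α i j * x j + β i j * (1 - x j)) +
        ∑ j ∈ S, (1 - x j) := by
      rw [← Finset.sum_add_distrib]
      refine Finset.sum_le_sum fun j _ => ?_
      nlinarith [hα01 i j, hβ01 i j, hx01 j]
    have e5 : ∑ j ∈ F.erase z \ S, β i j ≤
        ∑ j ∈ F.erase z \ S, (α i j * x j + β i j * (1 - x j)) + ∑ j ∈ F.erase z \ S, x j := by
      rw [← Finset.sum_add_distrib]
      refine Finset.sum_le_sum fun j _ => ?_
      nlinarith [hα01 i j, hβ01 i j, hx01 j]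
    have h6 : ∑ j ∈ N ∪ S, α i j + ∑ j ∈ Z ∪ (F.erase z \ S), β i j <
        2 + max (X i).card (Y i).card := by
      rw [Finset.sum_union dNS, Finset.sum_union dZT]
      linarith
    rw [hαs, hβs] at h6
    have h7 : ((N ∪ S) ∩ X i).card + ((Z ∪ (F.erase z \ S)) ∩ Y i).card <
        2 + max (X i).card (Y i).card := by exact_mod_cast h6
    omega

end Balancing

/-! ### Rounding with two prescribed sums. -/

section Rounding

variable {E : Type*} [Fintype E]

theorem sum_mul_one_sub_le {x : E → ℝ} {F : Finset E} (hF : ∀ j ∉ F, x j = 0 ∨ x j = 1) :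
    ∑ j, x j * (1 - x j) ≤ (F.card : ℝ) / 4 := by
  classical
  have h1 : ∑ j, x j * (1 - x j) = ∑ j ∈ F, x j * (1 - x j) := by
    refine (Finset.sum_subset (Finset.subset_univ F) fun j _ hj => ?_).symm
    rcases hF j hj with h | h <;> simp [h]
  have h2 : ∑ j ∈ F, x j * (1 - x j) ≤ F.card • (1 / 4 : ℝ) :=
    Finset.sum_le_card_nsmul _ _ _ fun j _ => by nlinarith [sq_nonneg (x j - 1 / 2)]
  rw [nsmul_eq_mul] at h2
  linarith

variable [DecidableEq E]

/-- A point of the unit cube with integral sums over `U` and `V` can be rounded, keeping these sums,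
to a nearby `0/1`-vector. The term with `U ∩ V` breaks ties. -/
theorem exists_close_rounding {U V : Finset E} {x : E → ℝ}
    (hx : ∀ j, 0 ≤ x j ∧ x j ≤ 1) {m : ℤ} (hxU : ∑ j ∈ U, x j = m) (hxV : ∑ j ∈ V, x j = m)
    (hUV : U ∪ V = Finset.univ) :
    ∃ y : E → ℝ, (∀ j, y j = 0 ∨ y j = 1) ∧ (∀ j, x j = 0 ∨ x j = 1 → y j = x j) ∧
      ∑ j ∈ U, y j = m ∧ ∑ j ∈ V, y j = m ∧
      ∑ j, (y j - x j) ^ 2 ≤ ∑ j, x j * (1 - x j) + 1 / 6 * ∑ j ∈ U ∩ V, (y j - x j) := by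
  have hind : ∀ (A : Finset E) (f : E → ℝ), ∑ j, (if j ∈ A then (1 : ℝ) else 0) * f j =
      ∑ j ∈ A, f j := fun A f => by simp [ite_mul, Finset.sum_ite_mem]
  let R : Bool → E → ℝ := fun b j => if j ∈ (if b then U else V) then 1 else 0
  -- For a `0/1` vector `y`, the squared distance to `x` is affine in `y` with linear part `-2 (x -
  -- 1/2)`, so maximising `l` nearly minimises this distance. The box below freezes the coordinates
  -- of `x` that are already integral.
  let l : E → ℝ := fun j => x j - 1 / 2 + 1 / 12 * if j ∈ U ∩ V then (1 : ℝ) else 0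
  let lo : E → ℝ := fun j => if x j = 1 then 1 else 0
  let hi : E → ℝ := fun j => if x j = 0 then 0 else 1
  obtain ⟨y, hbox, hR, hl, hext⟩ := exists_basic_solution lo hi R (J := fun _ => {(m : ℝ)})
    (fun _ => isClosed_singleton) l x (fun j => by
      have := hx j
      simp only [lo, hi]
      split_ifs <;> constructor <;> linarith) (fun b => by
      cases b <;> simp only [R, hind] <;> simp [hxU, hxV])
  have hyU : ∑ j ∈ U, y j = m := by
    have := hR true
    rwa [hind, Set.mem_singleton_iff] at this
  have hyV : ∑ j ∈ V, y j = m := by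
    have := hR false
    rwa [hind, Set.mem_singleton_iff] at this
  have hy01 : ∀ j, 0 ≤ y j ∧ y j ≤ 1 := fun j => by
    have := hbox j
    simp only [lo, hi] at this
    split_ifs at this <;> constructor <;> linarith
  have hyx : ∀ j, x j = 0 ∨ x j = 1 → y j = x j := fun j hj => by
    have := hbox j
    simp only [lo, hi] at this
    rcases hj with hj | hj <;> simp [hj] at this ⊢ <;> linarith
  have hfrac : ∀ j, ¬(y j = 0 ∨ y j = 1) → lo j < y j ∧ y j < hi j := fun j hj => by
    push Not at hj
    have h1 : x j ≠ 0 := fun h => hj.1 ((hyx j (Or.inl h)).trans h)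
    have h2 : x j ≠ 1 := fun h => hj.2 ((hyx j (Or.inr h)).trans h)
    simp only [lo, hi, h1, h2, if_false]
    exact ⟨lt_of_le_of_ne (hy01 j).1 hj.1.symm, lt_of_le_of_ne (hy01 j).2 hj.2⟩
  -- a set of rows cannot see only integral entries besides a single fractional one
  have hone : ∀ (A : Finset E) (a : E), a ∈ A → ∑ j ∈ A, y j = m →
      (∀ j ∈ A, j ≠ a → y j = 0 ∨ y j = 1) → y a = 0 ∨ y a = 1 := by
    intro A a ha hs hA
    rw [← Finset.add_sum_erase A y ha] at hs
    have : ∑ j ∈ A.erase a, y j = (((A.erase a).filter fun j => y j = 1).card : ℤ) := by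
      rw [Finset.card_filter]
      push_cast
      refine Finset.sum_congr rfl fun j hj => ?_
      rw [Finset.mem_erase] at hj
      rcases hA j hj.2 hj.1 with h | h <;> simp [h]
    rw [this] at hs
    set N : ℤ := (((A.erase a).filter fun j => y j = 1).card : ℤ)
    have h1 : y a = ((m - N : ℤ) : ℝ) := by push_cast; linarith
    have h2 := hy01 a
    rw [h1] at h2 ⊢
    have h3 : 0 ≤ m - N := by exact_mod_cast h2.1
    have h4 : m - N ≤ 1 := by exact_mod_cast h2.2
    have h5 : m - N = 0 ∨ m - N = 1 := by omega
    exact_mod_cast h5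
  -- two fractional entries in the same class can be moved against each other
  have hpair : ∀ a b, ¬(y a = 0 ∨ y a = 1) → ¬(y b = 0 ∨ y b = 1) → a ≠ b →
      ¬((a ∈ U ↔ b ∈ U) ∧ (a ∈ V ↔ b ∈ V)) := by
    intro a b ha hb hab ⟨h1, h2⟩
    have := hext (fun j => (if j = a then 1 else 0) - if j = b then 1 else 0) (fun j hj => by
      by_cases hja : j = a
      · exact hja ▸ hfrac a ha
      · by_cases hjb : j = b
        · exact hjb ▸ hfrac b hb
        · simp [hja, hjb] at hj) (fun r => by
      simp only [mul_sub, Finset.sum_sub_distrib, mul_ite, mul_one, mul_zero,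
        Finset.sum_ite_eq', Finset.mem_univ, if_true]
      cases r <;> simp [R, h1, h2])
    have := congrFun this a
    simp [hab] at this
  -- Raising `a` and `b` while lowering `c` preserves both sums.
  have hthree : ∀ a b c, a ∈ U → a ∉ V → b ∈ V → b ∉ U → c ∈ U → c ∈ V →
      ¬(y a = 0 ∨ y a = 1) → ¬(y b = 0 ∨ y b = 1) → ¬(y c = 0 ∨ y c = 1) → False := by
    intro a b c ha ha' hb hb' hc hc' fa fb fc
    have hac : a ≠ c := fun h => ha' (h ▸ hc')
    have hbc : b ≠ c := fun h => hb' (h ▸ hc)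
    have := hext (fun j => ((if j = a then 1 else 0) + if j = b then 1 else 0) -
        if j = c then 1 else 0) (fun j hj => by
      by_cases hja : j = a
      · exact hja ▸ hfrac a fa
      · by_cases hjb : j = b
        · exact hjb ▸ hfrac b fb
        · by_cases hjc : j = c
          · exact hjc ▸ hfrac c fc
          · simp [hja, hjb, hjc] at hj) (fun r => by
      simp only [mul_sub, mul_add, Finset.sum_add_distrib, Finset.sum_sub_distrib, mul_ite,
        mul_one, mul_zero, Finset.sum_ite_eq', Finset.mem_univ, if_true]
      cases r <;> simp [R, ha, ha', hb, hb', hc, hc'])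
    have := congrFun this c
    simp [hac.symm, hbc.symm] at this
  have hint : ∀ j, y j = 0 ∨ y j = 1 := by
    by_contra! hcon
    obtain ⟨a, ha0, ha1⟩ := hcon
    have fa : ¬(y a = 0 ∨ y a = 1) := by simp [ha0, ha1]
    have haUV : a ∈ U ∨ a ∈ V := Finset.mem_union.1 (hUV ▸ Finset.mem_univ a)
    -- every row containing a fractional entry contains another one, in another class
    have hother : ∀ (A : Finset E), ∑ j ∈ A, y j = m → ∀ a ∈ A, ¬(y a = 0 ∨ y a = 1) →
        ∃ b ∈ A, b ≠ a ∧ ¬(y b = 0 ∨ y b = 1) := by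
      intro A hA a haA fa
      by_contra! h
      exact fa (hone A a haA hA fun j hj hja => by
        have := h j hj hja
        tauto)
    -- there is a fractional entry in `U ∩ V`
    have hcommon : ∃ c, c ∈ U ∧ c ∈ V ∧ ¬(y c = 0 ∨ y c = 1) := by
      rcases haUV with haU | haV
      · by_cases haV : a ∈ V
        · exact ⟨a, haU, haV, fa⟩
        · obtain ⟨b, hb, hba, fb⟩ := hother U hyU a haU fa
          have := hpair b a fb fa hba
          refine ⟨b, hb, ?_, fb⟩
          tauto
      · by_cases haU : a ∈ U
        · exact ⟨a, haU, haV, fa⟩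
        · obtain ⟨b, hb, hba, fb⟩ := hother V hyV a haV fa
          have := hpair b a fb fa hba
          refine ⟨b, ?_, hb, fb⟩
          tauto
    obtain ⟨c, hcU, hcV, fc⟩ := hcommon
    obtain ⟨p, hp, hpc, fp⟩ := hother U hyU c hcU fc
    obtain ⟨q, hq, hqc, fq⟩ := hother V hyV c hcV fc
    have h1 := hpair p c fp fc hpc
    have h2 := hpair q c fq fc hqc
    exact hthree p q c hp (by tauto) hq (by tauto) hcU hcV fp fq fc
  refine ⟨y, hint, hyx, hyU, hyV, ?_⟩
  have hexp : ∀ z : E → ℝ, ∑ j, l j * z j = ∑ j, (x j - 1 / 2) * z j +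
      1 / 12 * ∑ j ∈ U ∩ V, z j := by
    intro z
    rw [← hind (U ∩ V), Finset.mul_sum, ← Finset.sum_add_distrib]
    exact Finset.sum_congr rfl fun j _ => by simp only [l]; ring
  rw [hexp, hexp] at hl
  have hsq : ∑ j, (y j - x j) ^ 2 = ∑ j, x j * (1 - x j) -
      2 * (∑ j, (x j - 1 / 2) * y j - ∑ j, (x j - 1 / 2) * x j) := by
    rw [← Finset.sum_sub_distrib, Finset.mul_sum, ← Finset.sum_sub_distrib]
    refine Finset.sum_congr rfl fun j _ => ?_
    rcases hint j with h | h <;> rw [h] <;> ring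
  rw [hsq, Finset.sum_sub_distrib]
  linarith

end Rounding

/-! ### Effect of the rounding error on weights. -/

section RoundingError

variable {E : Type*} [Fintype E]

theorem sq_sum_mul_le {F : Finset E} {e : E → ℝ} (he : ∀ j ∉ F, e j = 0) (h : E → ℝ) :
    (∑ j, h j * e j) ^ 2 ≤ (∑ j ∈ F, h j ^ 2) * ∑ j, e j ^ 2 := by
  have h1 : ∑ j, h j * e j = ∑ j ∈ F, h j * e j :=
    (Finset.sum_subset (Finset.subset_univ F) fun j _ hj => by simp [he j hj]).symm
  have h2 : ∑ j, e j ^ 2 = ∑ j ∈ F, e j ^ 2 :=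
    (Finset.sum_subset (Finset.subset_univ F) fun j _ hj => by simp [he j hj]).symm
  rw [h1, h2]
  exact Finset.sum_mul_sq_le_sq_mul_sq _ _ _

variable [DecidableEq E]

/-- A rounding error `e`, supported on at most six elements, small in the Euclidean norm and with
vanishing sums over `U` and `V`. -/
structure IsSmallError (U V F : Finset E) (e : E → ℝ) : Prop where
  support : ∀ j ∉ F, e j = 0
  sum_left : ∑ j ∈ U, e j = 0
  sum_right : ∑ j ∈ V, e j = 0
  card_le : F.card ≤ 6
  card_le_of_subset : F ⊆ U ∩ V → F.card ≤ 5
  sum_sq_le : ∑ j, e j ^ 2 ≤ (F.card : ℝ) / 4 + 1 / 6 * ∑ j ∈ U ∩ V, e j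

variable {U V F : Finset E} {e : E → ℝ}

theorem IsSmallError.sum_eq (he : IsSmallError U V F e) (hUV : U ∪ V = Finset.univ) :
    ∑ j, e j = -∑ j ∈ U ∩ V, e j := by
  have := Finset.sum_union_inter (s₁ := U) (s₂ := V) (f := e)
  rw [hUV, he.sum_left, he.sum_right] at this
  linarith

theorem IsSmallError.sum_sq_le' (he : IsSmallError U V F e) :
    ∑ j, e j ^ 2 ≤ 3 / 2 + 1 / 6 * ∑ j ∈ U ∩ V, e j := by
  have h1 := he.sum_sq_le
  have h2 : (F.card : ℝ) ≤ 6 := by exact_mod_cast he.card_le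
  linarith

theorem IsSmallError.sq_sum_mul_le (he : IsSmallError U V F e) {h : E → ℝ} {K : ℝ}
    (hh : ∀ j, h j ^ 2 ≤ K) (hK : 0 ≤ K) :
    (∑ j, h j * e j) ^ 2 ≤ 6 * K * (3 / 2 + 1 / 6 * ∑ j ∈ U ∩ V, e j) := by
  have h1 : ∑ j ∈ F, h j ^ 2 ≤ F.card • K := Finset.sum_le_card_nsmul _ _ _ fun j _ => hh j
  have h2 : (F.card : ℝ) ≤ 6 := by exact_mod_cast he.card_le
  rw [nsmul_eq_mul] at h1
  have h3 : ∑ j ∈ F, h j ^ 2 ≤ 6 * K := h1.trans (by gcongr)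
  have h4 : 0 ≤ ∑ j, e j ^ 2 := Finset.sum_nonneg fun j _ => sq_nonneg _
  exact (_root_.sq_sum_mul_le he.support h).trans
    (mul_le_mul h3 he.sum_sq_le' h4 (by positivity))

/-- Cauchy–Schwarz after recentring `w`. If `δ ≥ 0`, recentre by `1/2`, whose pairing with `e` is
`-δ/2`. If `δ < 0`, recentre by a third of `1_U + 1_V`, which `e` annihilates; the bound `4 + 4δ/9`
on the square is then strictly below 4 thanks to the tie-breaking term. -/
theorem IsSmallError.sum_lt_two (he : IsSmallError U V F e) (hUV : U ∪ V = Finset.univ)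
    {w : E → ℝ} (hw : ∀ j, w j = 0 ∨ w j = 1) : ∑ j, w j * e j < 2 := by
  by_contra! hcon
  set δ := ∑ j ∈ U ∩ V, e j with hδ
  rcases le_or_gt 0 δ with h0 | h0
  · have h1 := he.sq_sum_mul_le (h := fun j => w j - 1 / 2) (K := 1 / 4)
      (fun j => by rcases hw j with h | h <;> rw [h] <;> norm_num) (by norm_num)
    have h2 : ∑ j, (w j - 1 / 2) * e j = ∑ j, w j * e j + δ / 2 := by
      simp only [sub_mul, Finset.sum_sub_distrib, ← Finset.mul_sum, he.sum_eq hUV]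
      ring
    rw [h2] at h1
    nlinarith
  · have h1 := he.sq_sum_mul_le (h := fun j => w j - 1 / 3 * ((if j ∈ U then 1 else 0) +
      if j ∈ V then 1 else 0)) (K := 4 / 9)
      (fun j => by
        have hj : j ∈ U ∨ j ∈ V := Finset.mem_union.1 (hUV ▸ Finset.mem_univ j)
        rcases hw j with h | h <;> by_cases hu : j ∈ U <;> by_cases hv : j ∈ V <;>
          simp [h, hu, hv] at hj ⊢ <;> norm_num) (by norm_num)
    have h2 : ∑ j, (w j - 1 / 3 * ((if j ∈ U then 1 else 0) + if j ∈ V then 1 else 0)) * e j =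
        ∑ j, w j * e j := by
      have h3 : ∀ j, (w j - 1 / 3 * ((if j ∈ U then 1 else 0) + if j ∈ V then 1 else 0)) * e j =
          w j * e j - 1 / 3 * ((if j ∈ U then e j else 0) + if j ∈ V then e j else 0) := by
        intro j
        split_ifs <;> ring
      rw [Finset.sum_congr rfl fun j _ => h3 j, Finset.sum_sub_distrib, ← Finset.mul_sum,
        Finset.sum_add_distrib, Finset.sum_ite_mem, Finset.sum_ite_mem, Finset.univ_inter,
        Finset.univ_inter, he.sum_left, he.sum_right]
      ring
    rw [h2] at h1
    nlinarith

/-- Recentring by half of `1_U + 1_V` leaves squares at most 1 on `U ∩ V` and `1/4` elsewhere. With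
at most four points of `F` in `U ∩ V`, the crude bound `δ < 2` suffices. With five, at most one
point of `F` lies outside, so `F` misses `U \ V` or `V \ U`, forcing `δ = 0`. Six are excluded by
`card_le_of_subset`. -/
theorem IsSmallError.sum_lt_three (he : IsSmallError U V F e) (hUV : U ∪ V = Finset.univ)
    {w : E → ℝ} (hw0 : ∀ j, 0 ≤ w j) (hw2 : ∀ j, w j ≤ 2) (hw1 : ∀ j ∉ U ∩ V, w j ≤ 1) :
    ∑ j, w j * e j < 3 := by
  by_contra! hcon
  set δ := ∑ j ∈ U ∩ V, e j with hδ
  have h1 := _root_.sq_sum_mul_le he.support fun j => w j - 1 / 2 * ((if j ∈ U then 1 else 0) +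
      if j ∈ V then 1 else 0)
  have h2 : ∑ j, (w j - 1 / 2 * ((if j ∈ U then 1 else 0) + if j ∈ V then 1 else 0)) * e j =
      ∑ j, w j * e j := by
    have h3 : ∀ j, (w j - 1 / 2 * ((if j ∈ U then 1 else 0) + if j ∈ V then 1 else 0)) * e j =
        w j * e j - 1 / 2 * ((if j ∈ U then e j else 0) + if j ∈ V then e j else 0) := by
      intro j
      split_ifs <;> ring
    rw [Finset.sum_congr rfl fun j _ => h3 j, Finset.sum_sub_distrib, ← Finset.mul_sum,
      Finset.sum_add_distrib, Finset.sum_ite_mem, Finset.sum_ite_mem, Finset.univ_inter,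
      Finset.univ_inter, he.sum_left, he.sum_right]
    ring
  rw [h2] at h1
  have h4 : ∑ j ∈ F, (w j - 1 / 2 * ((if j ∈ U then 1 else 0) + if j ∈ V then 1 else 0)) ^ 2 ≤
      (F.card : ℝ) / 4 + 3 / 4 * (F ∩ (U ∩ V)).card := by
    have h5 : ∀ j ∈ F, (w j - 1 / 2 * ((if j ∈ U then 1 else 0) + if j ∈ V then 1 else 0)) ^ 2 ≤
        1 / 4 + 3 / 4 * if j ∈ U ∩ V then (1 : ℝ) else 0 := by
      intro j _
      have hj : j ∈ U ∨ j ∈ V := Finset.mem_union.1 (hUV ▸ Finset.mem_univ j)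
      have a0 := hw0 j
      have a1 := hw1 j
      have a2 := hw2 j
      by_cases hu : j ∈ U <;> by_cases hv : j ∈ V <;> simp [hu, hv] at hj a1 ⊢ <;> nlinarith
    refine (Finset.sum_le_sum h5).trans (le_of_eq ?_)
    rw [Finset.sum_add_distrib, ← Finset.mul_sum, Finset.sum_ite_mem]
    simp
    ring
  have hN0 : 0 ≤ ∑ j, e j ^ 2 := Finset.sum_nonneg fun j _ => sq_nonneg _
  have hN := he.sum_sq_le'
  have hc6 := he.card_le
  have hc6' : (F.card : ℝ) ≤ 6 := by exact_mod_cast hc6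
  have h9 : (9 : ℝ) ≤ (∑ j, w j * e j) ^ 2 := by nlinarith
  by_cases hr : (F ∩ (U ∩ V)).card ≤ 4
  · have hr' : ((F ∩ (U ∩ V)).card : ℝ) ≤ 4 := by exact_mod_cast hr
    have h6 := he.sq_sum_mul_le (h := fun j => if j ∈ U ∩ V then 1 else -1) (K := 1)
      (fun j => by split_ifs <;> norm_num) (by norm_num)
    have h7 : ∑ j, (if j ∈ U ∩ V then (1 : ℝ) else -1) * e j = 3 * δ := by
      have h8 : ∀ j, (if j ∈ U ∩ V then (1 : ℝ) else -1) * e j =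
          2 * (if j ∈ U ∩ V then e j else 0) - e j := by
        intro j
        split_ifs <;> ring
      rw [Finset.sum_congr rfl fun j _ => h8 j, Finset.sum_sub_distrib, ← Finset.mul_sum,
        Finset.sum_ite_mem, Finset.univ_inter, he.sum_eq hUV]
      ring
    rw [h7] at h6
    have hδ2 : δ < 2 := by nlinarith
    have h10 : (∑ j ∈ F, (w j - 1 / 2 * ((if j ∈ U then 1 else 0) +
        if j ∈ V then 1 else 0)) ^ 2) * ∑ j, e j ^ 2 ≤ 9 / 2 * ∑ j, e j ^ 2 :=
      mul_le_mul_of_nonneg_right (by linarith) hN0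
    linarith
  · push Not at hr
    have h6 : (F ∩ (U ∩ V)).card + (F \ (U ∩ V)).card = F.card :=
      Finset.card_inter_add_card_sdiff _ _
    have hr5 : (F ∩ (U ∩ V)).card ≤ 5 := by
      by_cases hsub : F ⊆ U ∩ V
      · exact (Finset.card_le_card Finset.inter_subset_left).trans (he.card_le_of_subset hsub)
      · have := Finset.card_pos.2 (Finset.sdiff_nonempty.2 hsub)
        omega
    have hone : (F \ (U ∩ V)).card ≤ 1 := by omega
    have hδ0 : δ = 0 := by
      by_cases hex : ∃ a ∈ F, a ∈ U ∧ a ∉ V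
      · obtain ⟨a, haF, haU, haV⟩ := hex
        rw [← he.sum_right]
        refine Finset.sum_subset Finset.inter_subset_right fun j hjV hj =>
          he.support j fun hjF => ?_
        have := Finset.card_le_one.1 hone j (Finset.mem_sdiff.2 ⟨hjF, hj⟩) a
          (Finset.mem_sdiff.2 ⟨haF, fun h => haV (Finset.mem_inter.1 h).2⟩)
        exact haV (this ▸ hjV)
      · rw [← he.sum_left]
        exact Finset.sum_subset Finset.inter_subset_left fun j hjU hj =>
          he.support j fun hjF => hex ⟨j, hjF, hjU, fun h => hj (Finset.mem_inter.2 ⟨hjU, h⟩)⟩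
    have hr5' : ((F ∩ (U ∩ V)).card : ℝ) ≤ 5 := by exact_mod_cast hr5
    have h10 : (∑ j ∈ F, (w j - 1 / 2 * ((if j ∈ U then 1 else 0) +
        if j ∈ V then 1 else 0)) ^ 2) * ∑ j, e j ^ 2 ≤ 21 / 4 * ∑ j, e j ^ 2 :=
      mul_le_mul_of_nonneg_right (by linarith) hN0
    rw [← hδ, hδ0] at hN
    linarith

/-- Choosing `m`-element subsets of `U` and `V` with the same trace on `U ∩ V` subject to four
upper bounds on weights. -/
theorem exists_light_subset {m : ℕ} (hUV : U ∪ V = Finset.univ) (hU : U.card = 2 * m + 1)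
    (hV : V.card = 2 * m + 1) (w : Fin 4 → E → ℤ) (t : Fin 4 → ℤ)
    (h : ∀ i, ((∀ j, w i j = 0 ∨ w i j = 1) ∧ ∑ j, w i j ≤ 2 * m + 1 ∧ (m : ℤ) + 1 ≤ t i) ∨
      ((∀ j, 0 ≤ w i j) ∧ (∀ j, w i j ≤ 2) ∧ (∀ j ∉ U ∩ V, w i j ≤ 1) ∧ (m : ℤ) + 2 ≤ t i ∧
        ∑ j, w i j + 1 - m ≤ t i)) :
    ∃ S : Finset E, (S ∩ U).card = m ∧ (S ∩ V).card = m ∧ ∀ i, ∑ j ∈ S, w i j ≤ t i := by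
  have hind : ∀ (A : Finset E) (f : E → ℝ), ∑ j, (if j ∈ A then (1 : ℝ) else 0) * f j =
      ∑ j ∈ A, f j := fun A f => by simp [ite_mul, Finset.sum_ite_mem]
  have hm : (0 : ℝ) < 2 * m + 1 := by positivity
  -- The constant point leaves room 1 for `0/1` weights and 2 for the others; rounding costs less
  -- than one unit more than that room.
  have hτ : ∀ i, ∃ τ : ℝ, ∑ j, (w i j : ℝ) * ((m : ℝ) / (2 * m + 1)) ≤ τ ∧
      ∀ F e, IsSmallError U V F e → τ + ∑ j, (w i j : ℝ) * e j < t i + 1 := by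
    intro i
    rcases h i with ⟨h1, h2, h3⟩ | ⟨h1, h2, h3, h4, h5⟩
    · refine ⟨t i - 1, ?_, fun F e he => ?_⟩
      · rw [← Finset.sum_mul, ← mul_div_assoc, div_le_iff₀ hm]
        have h2' : ∑ j, (w i j : ℝ) ≤ 2 * m + 1 := by exact_mod_cast h2
        have h3' : (m : ℝ) + 1 ≤ t i := by exact_mod_cast h3
        nlinarith [(Nat.cast_nonneg m : (0 : ℝ) ≤ m)]
      · have := he.sum_lt_two hUV (w := fun j => (w i j : ℝ)) fun j => by exact_mod_cast h1 j
        linarith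
    · refine ⟨t i - 2, ?_, fun F e he => ?_⟩
      · rw [← Finset.sum_mul, ← mul_div_assoc, div_le_iff₀ hm]
        have h4' : (m : ℝ) + 2 ≤ t i := by exact_mod_cast h4
        have h5' : ∑ j, (w i j : ℝ) + 1 - m ≤ t i := by exact_mod_cast h5
        have hm0 : (0 : ℝ) ≤ m := Nat.cast_nonneg m
        rcases le_total (∑ j, (w i j : ℝ)) (2 * m + 1) with h6 | h6 <;> nlinarith
      · have := he.sum_lt_three hUV (w := fun j => (w i j : ℝ))
          (fun j => by exact_mod_cast h1 j) (fun j => by exact_mod_cast h2 j)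
          fun j hj => by exact_mod_cast h3 j hj
        linarith
  choose τ hτ₁ hτ₂ using hτ
  let R : Option (Option (Fin 4)) → E → ℝ := fun r => r.elim (fun j => if j ∈ U then 1 else 0)
    fun s => s.elim (fun j => if j ∈ V then 1 else 0) fun i j => w i j
  let J : Option (Option (Fin 4)) → Set ℝ := fun r => r.elim {(m : ℝ)}
    fun s => s.elim {(m : ℝ)} fun i => Set.Iic (τ i)
  obtain ⟨x, hx, hxR, -, hext⟩ := exists_basic_solution (fun _ : E => (0 : ℝ)) (fun _ => 1) R
    (J := J) (by rintro (_ | _ | i) <;> simp [J, isClosed_Iic]) (fun _ => 0)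
    (fun _ => (m : ℝ) / (2 * m + 1)) (fun _ => ⟨by positivity, by
      rw [div_le_one hm]; linarith [(Nat.cast_nonneg m : (0 : ℝ) ≤ m)]⟩) (by
      rintro (_ | _ | i)
      · simp only [R, J, Option.elim, hind, Finset.sum_const, hU, nsmul_eq_mul,
          Set.mem_singleton_iff]
        push_cast
        field_simp
      · simp only [R, J, Option.elim, hind, Finset.sum_const, hV, nsmul_eq_mul,
          Set.mem_singleton_iff]
        push_cast
        field_simp
      · exact hτ₁ i)
  have hxU : ∑ j ∈ U, x j = ((m : ℤ) : ℝ) := by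
    have := hxR none
    simp only [R, J, Option.elim, hind, Set.mem_singleton_iff] at this
    exact_mod_cast this
  have hxV : ∑ j ∈ V, x j = ((m : ℤ) : ℝ) := by
    have := hxR (some none)
    simp only [R, J, Option.elim, hind, Set.mem_singleton_iff] at this
    exact_mod_cast this
  set F : Finset E := Finset.univ.filter fun j => 0 < x j ∧ x j < 1 with hF
  have hFout : ∀ j ∉ F, x j = 0 ∨ x j = 1 := by
    intro j hj
    obtain ⟨h0, h1⟩ := hx j
    rcases h0.eq_or_lt with h0 | h0
    · exact Or.inl h0.symm
    · refine Or.inr (le_antisymm h1 ?_)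
      by_contra! hlt
      exact hj (by simp [hF, h0, hlt])
  have hg : ∀ g : E → ℝ, (∀ j ∉ F, g j = 0) → ∀ j, g j ≠ 0 → 0 < x j ∧ x j < 1 := by
    intro g hg j hj
    by_contra hn
    exact hj (hg j (by simpa [hF] using hn))
  have hF6 : F.card ≤ 6 := card_le_of_rows_injective R F fun g hgF => hext g (hg g hgF)
  -- On `U ∩ V` the rows of `U` and `V` coincide, so one of the six is redundant.
  have hF5 : F ⊆ U ∩ V → F.card ≤ 5 := by
    intro hsub
    refine card_le_of_rows_injective (fun s => R (some s)) F fun g hgF hgR =>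
      hext g (hg g hgF) ?_
    rintro (_ | s)
    · have h1 := hgR none
      simp only [R, Option.elim, hind] at h1 ⊢
      have h2 : ∀ A : Finset E, F ⊆ A → ∑ j ∈ A, g j = ∑ j ∈ F, g j := fun A hA =>
        (Finset.sum_subset hA fun j _ hj => hgF j hj).symm
      rw [h2 _ (hsub.trans Finset.inter_subset_left)]
      rwa [h2 _ (hsub.trans Finset.inter_subset_right)] at h1
    · exact hgR s
  obtain ⟨y, hy01, hyx, hyU, hyV, hyd⟩ := exists_close_rounding hx hxU hxV hUV
  have herr : IsSmallError U V F fun j => y j - x j :=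
    { support := fun j hj => by rw [hyx j (hFout j hj), sub_self]
      sum_left := by rw [Finset.sum_sub_distrib, hxU, hyU, sub_self]
      sum_right := by rw [Finset.sum_sub_distrib, hxV, hyV, sub_self]
      card_le := hF6
      card_le_of_subset := hF5
      sum_sq_le := hyd.trans (by linarith [sum_mul_one_sub_le hFout]) }
  set S : Finset E := Finset.univ.filter fun j => y j = 1 with hS
  have hyS : ∀ j, y j = if j ∈ S then 1 else 0 := by
    intro j
    rcases hy01 j with h | h <;> simp [hS, h]
  refine ⟨S, ?_, ?_, fun i => ?_⟩
  · rw [Finset.sum_congr rfl fun j _ => hyS j, Finset.sum_ite_mem] at hyU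
    simp only [Finset.sum_const, nsmul_eq_mul, mul_one, Finset.inter_comm U] at hyU
    exact_mod_cast hyU
  · rw [Finset.sum_congr rfl fun j _ => hyS j, Finset.sum_ite_mem] at hyV
    simp only [Finset.sum_const, nsmul_eq_mul, mul_one, Finset.inter_comm V] at hyV
    exact_mod_cast hyV
  · have h1 := hτ₂ i F _ herr
    have h2 : ∑ j, (w i j : ℝ) * x j ≤ τ i := hxR (some (some i))
    have h3 : ∑ j ∈ S, (w i j : ℝ) = ∑ j, (w i j : ℝ) * x j +
        ∑ j, (w i j : ℝ) * (y j - x j) := by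
      rw [← Finset.sum_add_distrib, ← hind]
      refine Finset.sum_congr rfl fun j _ => ?_
      rw [← hyS j]
      ring
    have h4 : ∑ j ∈ S, (w i j : ℝ) < t i + 1 := by linarith
    have h5 : ∑ j ∈ S, w i j < t i + 1 := by exact_mod_cast h4
    omega

end RoundingError

/-! ### From path colourings to theta graphs. -/

section Theta

/-- To colour a theta graph it suffices to colour the two branch vertices so that the colouring
extends to every path. -/
theorem exists_theta_colouring {q : ℕ} {k : Fin q → ℕ} (hk : ∀ i, 1 ≤ k i) {C : Type w}
    [DecidableEq C] {m : ℕ} (L : ThetaVertex k → Finset C) {A B : Finset C}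
    (hA : A ⊆ L ThetaVertex.u) (hB : B ⊆ L ThetaVertex.v) (hAm : A.card = m) (hBm : B.card = m)
    (h : ∀ i, PathColourable m A B (k i - 1) fun j => L (thetaPath k i (j + 1))) :
    ∃ φ : ThetaVertex k → Finset C, (∀ x, (φ x).card = m) ∧ (∀ x, φ x ⊆ L x) ∧
      ∀ x y, (thetaGraph k).Adj x y → Disjoint (φ x) (φ y) := by
  choose ψ h0 h1 h2 h3 using h
  let φ : ThetaVertex k → Finset C := fun x => match x with
    | ThetaVertex.u => A
    | ThetaVertex.v => B
    | ThetaVertex.inner i j => ψ i (j + 1)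
  have hφ : ∀ i j, j ≤ k i → φ (thetaPath k i j) = ψ i j := by
    intro i j hj
    rcases Nat.eq_zero_or_pos j with rfl | hj0
    · exact (h0 i).symm
    · have hki := hk i
      rw [thetaPath, if_neg hj0.ne']
      split_ifs with hlt
      · change ψ i (j - 1 + 1) = ψ i j
        rw [Nat.sub_add_cancel hj0]
      · have : j = k i - 1 + 1 := by omega
        rw [this, h1]
  have hpath : ∀ i (j : Fin (k i - 1)), thetaPath k i (j + 1) = ThetaVertex.inner i j := by
    intro i j
    simp [thetaPath]
  have hadj : ∀ x y, (∃ i : Fin q, ∃ j : ℕ, j < k i ∧ x = thetaPath k i j ∧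
      y = thetaPath k i (j + 1)) → Disjoint (φ x) (φ y) := by
    rintro x y ⟨i, j, hj, rfl, rfl⟩
    rw [hφ i j hj.le, hφ i (j + 1) hj]
    exact h3 i j (by omega)
  refine ⟨φ, ?_, ?_, ?_⟩
  · rintro (_ | _ | ⟨i, j⟩)
    exacts [hAm, hBm, (h2 i j j.2).2]
  · rintro (_ | _ | ⟨i, j⟩)
    · exact hA
    · exact hB
    · rw [← hpath i j]
      rw [hφ i (j + 1) (by have := j.2; omega)]
      exact (h2 i j j.2).1
  · intro x y hxy
    rw [thetaGraph, SimpleGraph.fromRel_adj] at hxy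
    rcases hxy.2 with h | h
    · exact hadj x y h
    · exact (hadj y x h).symm

theorem IsChoosable.of_iso {V : Type u} {W : Type*} {G : SimpleGraph V} {H : SimpleGraph W}
    (e : G ≃g H) {a b : ℕ} (h : IsChoosable.{_, w} H a b) : IsChoosable.{u, w} G a b := by
  intro C L hL
  obtain ⟨φ, h1, h2, h3⟩ := h C (fun x => L (e.symm x)) fun _ => hL _
  exact ⟨fun v => φ (e v), fun v => h1 _, fun v => by simpa using h2 (e v),
    fun x y hxy => h3 _ _ (e.map_adj_iff.2 hxy)⟩

end Theta

/-! ### Choosing the colours of the branch vertices. -/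

section BranchColours

variable {C : Type w} [DecidableEq C]

/-- The number of times that colour `c` of both branch vertices counts towards the damage done to a
path with parameters `X`, `Y`, `Λ`. -/
def damageWeight (U V X Y Λ : Finset C) (c : C) : ℤ :=
  (if c ∈ U ∩ X then 1 else 0) + (if c ∈ V ∩ Y then 1 else 0) - if c ∈ U ∩ V ∩ Λ then 1 else 0

theorem sum_damageWeight (U V X Y Λ S : Finset C) :
    ∑ c ∈ S, damageWeight U V X Y Λ c =
      (S ∩ (U ∩ X)).card + (S ∩ (V ∩ Y)).card - (S ∩ (U ∩ V ∩ Λ)).card := by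
  simp only [damageWeight, Finset.sum_sub_distrib, Finset.sum_add_distrib, Finset.sum_ite_mem]
  simp

/-- `exists_light_subset` for subsets of an arbitrary type. -/
theorem exists_light_subset_of_finset {m : ℕ} {U V : Finset C} (hU : U.card = 2 * m + 1)
    (hV : V.card = 2 * m + 1) (w : Fin 4 → C → ℤ) (t : Fin 4 → ℤ)
    (h : ∀ i, ((∀ c ∈ U ∪ V, w i c = 0 ∨ w i c = 1) ∧ ∑ c ∈ U ∪ V, w i c ≤ 2 * m + 1 ∧
        (m : ℤ) + 1 ≤ t i) ∨
      ((∀ c ∈ U ∪ V, 0 ≤ w i c ∧ w i c ≤ 2 ∧ (c ∉ U ∩ V → w i c ≤ 1)) ∧ (m : ℤ) + 2 ≤ t i ∧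
        ∑ c ∈ U ∪ V, w i c + 1 - m ≤ t i)) :
    ∃ S : Finset C, (S ∩ U).card = m ∧ (S ∩ V).card = m ∧ ∀ i, ∑ c ∈ S, w i c ≤ t i := by
  have hcard : ∀ A ⊆ U ∪ V, ∀ S : Finset ↥(U ∪ V),
      (S.map (Function.Embedding.subtype _) ∩ A).card =
        (S ∩ Finset.univ.filter fun c => (c : C) ∈ A).card := by
    intro A hA S
    rw [← Finset.card_map (Function.Embedding.subtype _)]
    congr 1
    ext c
    simp only [Finset.mem_inter, Finset.mem_map, Finset.mem_filter, Finset.mem_univ, true_and,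
      Function.Embedding.subtype_apply]
    constructor
    · rintro ⟨⟨a, ha, rfl⟩, hc⟩
      exact ⟨a, ⟨ha, hc⟩, rfl⟩
    · rintro ⟨a, ⟨ha, hc⟩, rfl⟩
      exact ⟨⟨a, ha, rfl⟩, hc⟩
  have huniv : (Finset.univ : Finset ↥(U ∪ V)).map (Function.Embedding.subtype _) = U ∪ V :=
    Finset.attach_map_val
  have hUc := hcard U Finset.subset_union_left Finset.univ
  have hVc := hcard V Finset.subset_union_right Finset.univ
  rw [huniv, Finset.inter_eq_right.2 Finset.subset_union_left, Finset.univ_inter, hU] at hUc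
  rw [huniv, Finset.inter_eq_right.2 Finset.subset_union_right, Finset.univ_inter, hV] at hVc
  obtain ⟨S, h1, h2, h3⟩ := exists_light_subset
    (U := Finset.univ.filter fun c : ↥(U ∪ V) => (c : C) ∈ U)
    (V := Finset.univ.filter fun c : ↥(U ∪ V) => (c : C) ∈ V)
    (by ext c; simpa using Finset.mem_union.1 c.2) hUc.symm hVc.symm (fun i c => w i c) t
    (fun i => by
      rw [Finset.sum_coe_sort (U ∪ V) (w i)]
      rcases h i with ⟨a1, a2, a3⟩ | ⟨a1, a2, a3⟩
      · exact Or.inl ⟨fun c => a1 c c.2, a2, a3⟩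
      · exact Or.inr ⟨fun c => (a1 c c.2).1, fun c => (a1 c c.2).2.1, fun c hc =>
          (a1 c c.2).2.2 (by simpa using hc), a2, a3⟩)
  refine ⟨S.map (Function.Embedding.subtype _), ?_, ?_, fun i => ?_⟩
  · rw [hcard U Finset.subset_union_left, h1]
  · rw [hcard V Finset.subset_union_right, h2]
  · rw [Finset.sum_map]
    exact h3 i

/-- A path with an odd number of vertices imposes a condition on colour sets `S ∩ U`, `S ∩ V` at its
ends that `exists_light_subset_of_finset` can satisfy. -/
theorem exists_weight_odd {m a : ℕ} (ha : 1 ≤ a) (U V : Finset C) {L : ℕ → Finset C}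
    (hL : ∀ j, (L j).card = 2 * m + 1) :
    ∃ (w : C → ℤ) (t : ℤ), (∀ c ∈ U ∪ V, 0 ≤ w c ∧ w c ≤ 2 ∧ (c ∉ U ∩ V → w c ≤ 1)) ∧
      (m : ℤ) + 2 ≤ t ∧ ∑ c ∈ U ∪ V, w c + 1 - m ≤ t ∧
      ∀ S : Finset C, (S ∩ U).card = m → (S ∩ V).card = m → ∑ c ∈ S, w c ≤ t →
        PathColourable m (S ∩ U) (S ∩ V) (2 * a + 1) L := by
  obtain ⟨X, Y, Λ, t, h1, h2, h3, h4, h5, h6⟩ := exists_condition_odd V ha hL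
  refine ⟨damageWeight U V X Y Λ, t, fun c hc => ?_, h4, ?_, fun S hSU hSV hS => ?_⟩
  · have := @h3 c
    simp only [damageWeight, Finset.mem_inter, Finset.mem_union] at hc ⊢
    by_cases c1 : c ∈ U <;> by_cases c2 : c ∈ V <;> by_cases c3 : c ∈ X <;>
      by_cases c4 : c ∈ Y <;> by_cases c5 : c ∈ Λ <;> simp_all
  · rw [sum_damageWeight]
    have e1 : (U ∪ V) ∩ (U ∩ X) = U ∩ X :=
      Finset.inter_eq_right.2 (Finset.inter_subset_left.trans Finset.subset_union_left)
    have e2 : (U ∪ V) ∩ (V ∩ Y) = Y := by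
      ext c
      have := @h1 c
      simp only [Finset.mem_inter, Finset.mem_union]
      tauto
    have e3 : (U ∪ V) ∩ (U ∩ V ∩ Λ) = U ∩ Λ := by
      ext c
      have := @h2 c
      simp only [Finset.mem_inter, Finset.mem_union]
      tauto
    have e4 : (U ∩ X).card + Λ.card ≤ X.card + (U ∩ Λ).card := by
      have e5 : (U ∩ X) ∩ Λ = U ∩ Λ := by
        rw [Finset.inter_assoc, Finset.inter_eq_right.2 h3]
      have := Finset.card_union_add_card_inter (U ∩ X) Λ
      rw [e5] at this
      have := Finset.card_le_card (Finset.union_subset Finset.inter_subset_right h3 :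
        U ∩ X ∪ Λ ⊆ X)
      omega
    rw [e1, e2, e3]
    omega
  · refine h6 _ _ hSU hSV Finset.inter_subset_right ?_
    rw [sum_damageWeight] at hS
    have e1 : S ∩ U ∩ (S ∩ V) ∩ Λ = S ∩ (U ∩ V ∩ Λ) := by
      ext c
      simp only [Finset.mem_inter]
      tauto
    rwa [e1, Finset.inter_assoc, Finset.inter_assoc]

/-- With a single internal vertex the weight is the indicator of its list: at most `m + 1` of its
colours may be used at the ends. -/
theorem exists_weight_one {m : ℕ} (U V : Finset C) {L : ℕ → Finset C}
    (hL : ∀ j, (L j).card = 2 * m + 1) :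
    ∃ w : C → ℤ, (∀ c, w c = 0 ∨ w c = 1) ∧ ∑ c ∈ U ∪ V, w c ≤ 2 * m + 1 ∧
      ∀ S : Finset C, (S ∩ U).card = m → (S ∩ V).card = m → ∑ c ∈ S, w c ≤ m + 1 →
        PathColourable m (S ∩ U) (S ∩ V) 1 L := by
  have hs : ∀ S : Finset C, ∑ c ∈ S, (if c ∈ L 0 then (1 : ℤ) else 0) = (S ∩ L 0).card := by
    intro S
    simp [Finset.sum_ite_mem]
  refine ⟨fun c => if c ∈ L 0 then 1 else 0, fun c => (ite_eq_or_eq _ _ _).symm, ?_,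
    fun S hSU hSV hS => pathColourable_one hSU hSV hL ?_⟩
  · rw [hs]
    have := Finset.card_le_card (Finset.inter_subset_right : (U ∪ V) ∩ L 0 ⊆ L 0)
    rw [hL 0] at this
    exact_mod_cast this
  · rw [hs] at hS
    have : (L 0 ∩ (S ∩ U ∪ S ∩ V)).card ≤ (S ∩ L 0).card := Finset.card_le_card fun c => by
      simp only [Finset.mem_inter, Finset.mem_union]
      tauto
    have h' : (S ∩ L 0).card ≤ m + 1 := by exact_mod_cast hS
    omega

/-- Disjoint colour sets for the branch vertices that are compatible with three paths with an even
number of vertices. -/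
theorem exists_disjoint_branch_colours {m : ℕ} {U V : Finset C} (hU : U.card = 2 * m + 1)
    (hV : V.card = 2 * m + 1) (X Y : Fin 3 → Finset C) :
    ∃ A ⊆ U, ∃ B ⊆ V, A.card = m ∧ B.card = m ∧ Disjoint A B ∧
      ∀ i, (A ∩ X i).card + (B ∩ Y i).card ≤ 1 + max (X i).card (Y i).card := by
  have hUV : (U \ V).card = (V \ U).card := by
    have h1 := Finset.card_sdiff_add_card_inter U V
    have h2 := Finset.card_sdiff_add_card_inter V U
    rw [Finset.inter_comm V U] at h2
    omega
  let σ := Finset.equivOfCardEq hUV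
  -- The injection `g` into `V` fixes `U ∩ V` and sends the rest outside `U`, so `S` and `g(T)` are
  -- disjoint whenever `S` and `T` are.
  let g : U → C := fun c => if h : (c : C) ∈ V then c else σ ⟨c, Finset.mem_sdiff.2 ⟨c.2, h⟩⟩
  have hgV : ∀ c : U, (c : C) ∈ V → g c = c := fun c h => dif_pos h
  have hgout : ∀ c : U, (c : C) ∉ V → g c ∈ V \ U := fun c h => by
    simp only [g, h, dif_neg, not_false_eq_true]
    exact (σ _).2
  have hgmem : ∀ c, g c ∈ V := fun c => by
    by_cases h : (c : C) ∈ V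
    · rwa [hgV c h]
    · exact (Finset.mem_sdiff.1 (hgout c h)).1
  have hgU : ∀ c : U, g c ∈ U → g c = c := fun c hc => by
    by_cases h : (c : C) ∈ V
    · exact hgV c h
    · exact absurd hc (Finset.mem_sdiff.1 (hgout c h)).2
  have hinj : Function.Injective g := by
    intro c d hcd
    by_cases h : (c : C) ∈ V
    · have h1 := hgV c h
      have h2 := hgU d (by rw [← hcd, h1]; exact c.2)
      exact Subtype.ext (by rw [← h1, hcd, h2])
    · by_cases h' : (d : C) ∈ V
      · have h1 := hgV d h'
        have h2 := hgU c (by rw [hcd, h1]; exact d.2)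
        exact Subtype.ext (by rw [← h2, hcd, h1])
      · have h1 : (σ ⟨c, Finset.mem_sdiff.2 ⟨c.2, h⟩⟩ : C) =
            σ ⟨d, Finset.mem_sdiff.2 ⟨d.2, h'⟩⟩ := by
          simpa only [g, dif_neg h, dif_neg h'] using hcd
        have h2 := σ.injective (Subtype.ext h1)
        exact Subtype.ext (Subtype.mk.inj h2)
  obtain ⟨S, T, hST, hS, hT, hXY⟩ := exists_balanced_halves (E := U) (m := m) (by simpa using hU)
    (fun i => Finset.univ.filter fun c => (c : C) ∈ X i)
    (fun i => Finset.univ.filter fun c => g c ∈ Y i)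
  refine ⟨S.map (Function.Embedding.subtype _), ?_, T.map ⟨g, hinj⟩, ?_, by simpa using hS,
    by simpa using hT, ?_, fun i => ?_⟩
  · intro c hc
    obtain ⟨a, -, rfl⟩ := Finset.mem_map.1 hc
    exact a.2
  · intro c hc
    obtain ⟨a, -, rfl⟩ := Finset.mem_map.1 hc
    exact hgmem a
  · rw [Finset.disjoint_left]
    intro c hc hc'
    obtain ⟨a, ha, rfl⟩ := Finset.mem_map.1 hc
    obtain ⟨b, hb, hba⟩ := Finset.mem_map.1 hc'
    have h1 : g b = a := hba
    have h2 := hgU b (by rw [h1]; exact a.2)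
    have h3 : a = b := Subtype.ext (by rw [← h1, h2])
    exact Finset.disjoint_left.1 hST ha (h3 ▸ hb)
  · have key : ∀ (f : U ↪ C) (Z : Finset C) (R : Finset U),
        (R.map f ∩ Z).card = (R ∩ Finset.univ.filter fun c => f c ∈ Z).card := by
      intro f Z R
      rw [← Finset.card_map f]
      congr 1
      ext c
      simp only [Finset.mem_inter, Finset.mem_map, Finset.mem_filter, Finset.mem_univ, true_and]
      constructor
      · rintro ⟨⟨a, ha, rfl⟩, hc⟩
        exact ⟨a, ⟨ha, hc⟩, rfl⟩
      · rintro ⟨a, ⟨ha, hc⟩, rfl⟩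
        exact ⟨⟨a, ha, rfl⟩, hc⟩
    have hle : ∀ (f : U ↪ C) (Z : Finset C),
        (Finset.univ.filter fun c => f c ∈ Z).card ≤ Z.card := by
      intro f Z
      have := key f Z Finset.univ
      rw [Finset.univ_inter] at this
      exact this ▸ Finset.card_le_card Finset.inter_subset_right
    have h1 := hXY i
    rw [key, key]
    have h2 := hle (Function.Embedding.subtype _) (X i)
    have h3 := hle ⟨g, hinj⟩ (Y i)
    have h4 := max_le_max h2 h3
    exact h1.trans (Nat.add_le_add_left h4 1)

end BranchColours

/-! ### The three families. -/

section Main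

theorem isChoosable_theta_even {r s t : ℕ} (hr : 1 < r) (hs : 1 < s) (ht : 1 < t) (m : ℕ) :
    IsChoosable.{0, w} (thetaGraph ![2 * r, 2 * s, 2 * t]) (2 * m + 1) m := by
  classical
  set k : Fin 3 → ℕ := ![2 * r, 2 * s, 2 * t] with hk
  intro C L hL
  have hlen : ∀ i, ∃ a, 1 ≤ a ∧ k i - 1 = 2 * a + 1 := by
    intro i
    fin_cases i
    exacts [⟨r - 1, by omega, by simp [hk]; omega⟩, ⟨s - 1, by omega, by simp [hk]; omega⟩,
      ⟨t - 1, by omega, by simp [hk]; omega⟩]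
  choose a ha hka using hlen
  choose w b h1 h2 h3 h4 using fun i => exists_weight_odd (ha i) (L ThetaVertex.u)
    (L ThetaVertex.v) (L := fun j => L (thetaPath k i (j + 1))) (fun j => hL _)
  -- Three paths need only three weights; the fourth slot is filled by the zero weight.
  obtain ⟨S, hSU, hSV, hS⟩ := exists_light_subset_of_finset (hL ThetaVertex.u)
    (hL ThetaVertex.v) (Fin.cons 0 w) (Fin.cons (m + 1) b) (by
      intro i
      refine Fin.cases (Or.inl ?_) (fun i => Or.inr ?_) i
      · simp only [Fin.cons_zero, Pi.zero_apply, Finset.sum_const_zero]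
        exact ⟨by simp, by positivity, le_rfl⟩
      · simp only [Fin.cons_succ]
        exact ⟨h1 i, h2 i, h3 i⟩)
  refine exists_theta_colouring (fun i => ?_) L Finset.inter_subset_right
    Finset.inter_subset_right hSU hSV fun i => ?_
  · have := hka i
    omega
  · rw [hka i]
    exact h4 i S hSU hSV (by simpa using hS i.succ)

theorem isChoosable_theta_odd {r s t : ℕ} (hr : 0 < r) (hs : 0 < s) (ht : 0 < t) (m : ℕ) :
    IsChoosable.{0, w} (thetaGraph ![2 * r + 1, 2 * s + 1, 2 * t + 1]) (2 * m + 1) m := by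
  classical
  set k : Fin 3 → ℕ := ![2 * r + 1, 2 * s + 1, 2 * t + 1] with hk
  intro C L hL
  have hlen : ∀ i, ∃ a, 1 ≤ a ∧ k i = 2 * a + 1 := by
    intro i
    fin_cases i
    exacts [⟨r, hr, rfl⟩, ⟨s, hs, rfl⟩, ⟨t, ht, rfl⟩]
  choose a ha hka using hlen
  choose X Y b h1 h2 h3 h4 using fun i => exists_condition_even (L ThetaVertex.v) (ha i)
    (L := fun j => L (thetaPath k i (j + 1))) (fun j => hL _)
  obtain ⟨A, hA, B, hB, hAm, hBm, hAB, hXY⟩ :=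
    exists_disjoint_branch_colours (hL ThetaVertex.u) (hL ThetaVertex.v) X Y
  refine exists_theta_colouring (fun i => ?_) L hA hB hAm hBm fun i => ?_
  · have := hka i
    omega
  · rw [hka i, Nat.add_sub_cancel]
    refine h4 i A B hAm hBm hB hAB ?_
    have := hXY i
    have := h2 i
    have := h3 i
    omega

theorem isChoosable_theta_two_two_two {t : ℕ} (ht : 1 ≤ t) (m : ℕ) :
    IsChoosable.{0, w} (thetaGraph ![2, 2, 2, 2 * t]) (2 * m + 1) m := by
  classical
  set k : Fin 4 → ℕ := ![2, 2, 2, 2 * t] with hk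
  intro C L hL
  have hweight : ∀ i, ∃ (w : C → ℤ) (b : ℤ),
      (((∀ c ∈ L ThetaVertex.u ∪ L ThetaVertex.v, w c = 0 ∨ w c = 1) ∧
          ∑ c ∈ L ThetaVertex.u ∪ L ThetaVertex.v, w c ≤ 2 * m + 1 ∧ (m : ℤ) + 1 ≤ b) ∨
        ((∀ c ∈ L ThetaVertex.u ∪ L ThetaVertex.v, 0 ≤ w c ∧ w c ≤ 2 ∧
          (c ∉ L ThetaVertex.u ∩ L ThetaVertex.v → w c ≤ 1)) ∧ (m : ℤ) + 2 ≤ b ∧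
          ∑ c ∈ L ThetaVertex.u ∪ L ThetaVertex.v, w c + 1 - m ≤ b)) ∧
      ∀ S : Finset C, (S ∩ L ThetaVertex.u).card = m → (S ∩ L ThetaVertex.v).card = m →
        ∑ c ∈ S, w c ≤ b → PathColourable m (S ∩ L ThetaVertex.u) (S ∩ L ThetaVertex.v) (k i - 1)
          fun j => L (thetaPath k i (j + 1)) := by
    intro i
    have hlen : k i - 1 = 1 ∨ ∃ a, 1 ≤ a ∧ k i - 1 = 2 * a + 1 := by
      fin_cases i
      · exact Or.inl rfl
      · exact Or.inl rfl
      · exact Or.inl rfl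
      · rcases ht.eq_or_lt with rfl | ht
        · exact Or.inl rfl
        · exact Or.inr ⟨t - 1, by omega, by simp [hk]; omega⟩
    rcases hlen with h | ⟨a, ha, h⟩
    · obtain ⟨w, h1, h2, h3⟩ := exists_weight_one (m := m) (L ThetaVertex.u) (L ThetaVertex.v)
        (L := fun j => L (thetaPath k i (j + 1))) (fun j => hL _)
      exact ⟨w, m + 1, Or.inl ⟨fun c _ => h1 c, h2, le_rfl⟩, by rwa [h]⟩
    · obtain ⟨w, b, h1, h2, h3, h4⟩ := exists_weight_odd ha (L ThetaVertex.u) (L ThetaVertex.v)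
        (L := fun j => L (thetaPath k i (j + 1))) (fun j => hL _)
      exact ⟨w, b, Or.inr ⟨h1, h2, h3⟩, by rwa [h]⟩
  choose w b h1 h2 using hweight
  obtain ⟨S, hSU, hSV, hS⟩ := exists_light_subset_of_finset (hL ThetaVertex.u)
    (hL ThetaVertex.v) w b h1
  refine exists_theta_colouring (fun i => ?_) L Finset.inter_subset_right
    Finset.inter_subset_right hSU hSV fun i => h2 i S hSU hSV (hS i)
  fin_cases i
  exacts [one_le_two, one_le_two, one_le_two, by simp [hk]; omega]

end Main

theorem theorem1p3 {V : Type u} (G : SimpleGraph V)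
    (hG : (∃ r s t : ℕ, 1 < r ∧ 1 < s ∧ 1 < t ∧
            Nonempty (G ≃g thetaGraph ![2 * r, 2 * s, 2 * t])) ∨
          (∃ r s t : ℕ, 0 < r ∧ 0 < s ∧ 0 < t ∧
            Nonempty (G ≃g thetaGraph ![2 * r + 1, 2 * s + 1, 2 * t + 1])) ∨
          (∃ t : ℕ, 1 ≤ t ∧ Nonempty (G ≃g thetaGraph ![2, 2, 2, 2 * t])))
    (m : ℕ) (hm : 0 < m) :
    IsChoosable.{u, w} G (2 * m + 1) m := by
  rcases hG with ⟨r, s, t, hr, hs, ht, ⟨e⟩⟩ | ⟨r, s, t, hr, hs, ht, ⟨e⟩⟩ | ⟨t, ht, ⟨e⟩⟩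
  · exact (isChoosable_theta_even hr hs ht m).of_iso e
  · exact (isChoosable_theta_odd hr hs ht m).of_iso e
  · exact (isChoosable_theta_two_two_two ht m).of_iso e
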